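/- **Setting.** A P-time event graph (P-TEG) has $n$ transitions $t_1,\dots,t_n$ and finitely many places; each place $p$ has one upstream and one downstream transition, an initial marking in $\{0,1\}$, and a window $[\tau_p^-,\tau_p^+]$ with $0\le\tau_p^-\le\tau_p^+\le\infty$, and there is at most one place for given marking, upstream and downstream transition. If a place $p$ with marking $\mu$ leads from $t_j$ to $t_i$, put $A^\mu_{ij}=\tau_p^-$, $B^\mu_{ij}=\tau_p^+$; otherwise $A^\mu_{ij}=-\infty$, $B^\mu_{ij}=+\infty$. A finite trajectory $x(0),\dots,x(K)\in\mathbb R^n$ is consistent if $\max_j(A^0_{ij}+x_j(k))\le x_i(k)\le\min_j(B^0_{ij}+x_j(k))$ for all $i$ and $0\le k\le K$, and $\max_j(A^1_{ij}+x_j(k))\le x_i(k+1)\le\min_j(B^1_{ij}+x_j(k))$ and $x_i(k)\le x_i(k+1)$ for all $i$ and $0\le k<K$. The P-TEG is weakly consistent if for every $K\ge 0$ there is a consistent $x(0),\dots,x(K)$; otherwise the first token death occurs at the least $k$ for which there is no consistent $x(0),\dots,x(k)$. Let $P_{ij}=-B^1_{ji}$, $I_{ij}=\max(A^1_{ij},E_{ij})$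 with $E_{ii}=0$ and $E_{ij}=-\infty$ for $i\ne j$, and $C_{ij}=\max(A^0_{ij},-B^0_{ji})$. Let $M_K$ be the block tridiagonal $n(K+1)\times n(K+1)$ matrix with $C$ on the diagonal, $P$ directly above and $I$ directly below it, and $-\infty$ elsewhere. The graph $\mathcal G(M)$ of a matrix $M$ has an arc $j\to i$ of weight $M_{ij}$ iff $M_{ij}\ne-\infty$, and $\Gamma$ is the set of such graphs without circuits of positive weight. The periodic graph has nodes $\{1,\dots,n\}\times\mathbb Z$ and, for each $z$, arcs from $(j,z)$ to $(i,z-1)$, $(i,z+1)$, $(i,z)$ of weights $P_{ij}$, $I_{ij}$, $C_{ij}$, whenever these are not $-\infty$. Let $S_i$ be the set of pairs $(t,w)$ such that $w$ is the maximum weight of the paths from $(i,0)$ to $(i,t)$ in the periodic graph with at least $1$ and at most $n$ arcs. Let $R_{ij}$ be the maximum weight of the circuits with at least $1$ and at most $n^2$ arcs in the periodic graph which pass through both row $i$ and row $j$ ($R_{ij}=-\infty$ if there are none). **Statement.** Suppose that the P-TEG is not weakly consistent. Then there are $i,j$ with $R_{ij}\neq-\infty$, $(t,w)\in S_i$ and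 $(t',w')\in S_j$ such that the system $yt+y't'=0$, $yw+y'w'>0$ has a solution $(y,y')\in\mathbb N_0^2$. For all such $i,j,(t,w),(t',w')$, the system $$\tilde y t+\tilde y't'=0,\qquad \tilde y w+\tilde y'w'+R_{ij}>0$$ has a (componentwise) minimal solution in $\mathbb N_0^2$, and for every minimal solution $(\tilde y_m,\tilde y_m')$ the first token death occurs at some $$k\le\hat K=\tilde y_m|t|+2n+2\left\lfloor \tfrac{n^2}{2}\right\rfloor+1 .$$ This $k$ is the least $k$ with $\mathcal G(M_k)\notin\Gamma$, and it is the maximal number of times that all transitions can fire consistently, i.e. without violation of a constraint. Moreover, on a unit-cost machine with natural-number registers (constants, copying, addition, truncated subtraction, halving, comparison) and two-dimensional arrays of extended reals (the constants $0$ and $-\infty$, copying, negation, addition, maximum, comparison), there is one program that decides for all $n\ge1$, all P-TEGs and all $k$, given $n$, $k$ and $A^0,A^1,B^0,B^1$, whether $\mathcal G(M_k)\in\Gamma$, in $O((n(k+1))^3)$ steps; and binary search over $k\in\{0,\dots,\hat K\}$ with this test, given $n$, $\hat K$ and $A^0,A^1,B^0,B^1$, finds the exact $k$ of the first token death in $O(n^3\hat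 K^3\log\hat K)$ steps. The implied constants are absolute. -/

import Mathlib

open scoped NNReal ENNReal

/-! ## P-time event graphs -/

/-- A P-time event graph with transitions `t_0, …, t_{n-1}`: every place has exactly one upstream
and one downstream transition, initially holds 0 or 1 token, and carries a time window
`[lo p, hi p]` with `0 ≤ lo p ≤ hi p ≤ ∞`.  There is at most one place with given initial marking,
upstream and downstream transition, so that the characteristic matrices are well defined. -/
structure PTEG (n : ℕ) where
  Place : Type
  finite_place : Finite Place
  up : Place → Fin n
  down : Place → Fin n
  marking : Place → Fin 2
  lo : Place → ℝ≥0
  hi : Place → ℝ≥0∞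
  lo_le_hi : ∀ p, (lo p : ℝ≥0∞) ≤ hi p
  simple : Function.Injective fun p => (marking p, up p, down p)

/-! ## Max-plus matrices and weighted directed graphs

Extended reals are `EReal`.  Its addition satisfies `⊥ + ⊤ = ⊥`, so it is max-plus
multiplication; max-plus addition is the maximum. -/

/-- Max-plus matrix product. -/
noncomputable def mpMul {ι : Type} (A B : ι → ι → EReal) : ι → ι → EReal :=
  fun i h => ⨆ k, A i k + B k h

/-- Max-plus identity matrix. -/
noncomputable def mpOne {ι : Type} [DecidableEq ι] : ι → ι → EReal :=
  fun i j => if i = j then 0 else ⊥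

/-- Max-plus matrix power. -/
noncomputable def mpPow {ι : Type} [DecidableEq ι] (A : ι → ι → EReal) : ℕ → ι → ι → EReal
  | 0 => mpOne
  | r + 1 => mpMul (mpPow A r) A

/-- The precedence graph of `A` has no circuit of positive weight. -/
def InGamma {ι : Type} [DecidableEq ι] (A : ι → ι → EReal) : Prop :=
  ∀ r : ℕ, 1 ≤ r → ∀ i, mpPow A r i i ≤ 0

/-- A path with `r` arcs in the weighted directed graph on `V` in which there is an arc from `u`
to `v`, of weight `W u v`, if and only if `W u v ≠ -∞`. -/
structure WPath {V : Type} (W : V → V → EReal) (r : ℕ) where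
  node : Fin (r + 1) → V
  arc : ∀ k : Fin r, W (node k.castSucc) (node k.succ) ≠ ⊥

/-- The weight of a path: the sum of the weights of its arcs. -/
noncomputable def WPath.weight {V : Type} {W : V → V → EReal} {r : ℕ} (ρ : WPath W r) : ℝ :=
  ∑ k : Fin r, (W (ρ.node k.castSucc) (ρ.node k.succ)).toReal

namespace PTEG

variable {n : ℕ} (N : PTEG n)

/-- `A μ i j` is the lower bound of the window of the place with marking `μ` from `t_j` to `t_i`
(and `-∞` if there is no such place). -/
noncomputable def A (μ : Fin 2) (i j : Fin n) : EReal :=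
  ⨆ p : {p : N.Place // N.marking p = μ ∧ N.up p = j ∧ N.down p = i}, ((N.lo p.1 : ℝ) : EReal)

/-- `B μ i j` is the upper bound of the window of the place with marking `μ` from `t_j` to `t_i`
(and `+∞` if there is no such place). -/
noncomputable def B (μ : Fin 2) (i j : Fin n) : EReal :=
  ⨅ p : {p : N.Place // N.marking p = μ ∧ N.up p = j ∧ N.down p = i}, ((N.hi p.1 : ℝ≥0∞) : EReal)

/-- The finite trajectory `x 0, …, x K` of the dater function is consistent. -/
def ConsistentUpTo (K : ℕ) (x : ℕ → Fin n → ℝ) : Prop :=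
  (∀ k ≤ K, ∀ i,
    (⨆ j, N.A 0 i j + (x k j : EReal)) ≤ (x k i : EReal) ∧
    (x k i : EReal) ≤ ⨅ j, N.B 0 i j + (x k j : EReal)) ∧
  (∀ k < K, ∀ i,
    (⨆ j, N.A 1 i j + (x k j : EReal)) ≤ (x (k + 1) i : EReal) ∧
    (x (k + 1) i : EReal) ≤ ⨅ j, N.B 1 i j + (x k j : EReal)) ∧
  (∀ k < K, ∀ i, x k i ≤ x (k + 1) i)

/-- There are consistent finite trajectories of every length. -/
def WeaklyConsistent : Prop := ∀ K : ℕ, ∃ x, N.ConsistentUpTo K x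

/-- Every transition can fire `m` times without violation of a time constraint; `m = K + 1`
firings form a trajectory `x 0, …, x K`. -/
def AdmitsFirings : ℕ → Prop
  | 0 => True
  | K + 1 => ∃ x, N.ConsistentUpTo K x

/-- `k` is the index of the first token death: the least `k` for which no
trajectory `x 0, …, x k` is consistent. -/
def IsFirstDeath (k : ℕ) : Prop := IsLeast {K : ℕ | ¬ ∃ x, N.ConsistentUpTo K x} k

/-- The matrix `P`, the negative transpose of `B 1`. -/
noncomputable def matP (i j : Fin n) : EReal := - N.B 1 j i

/-- The matrix `I`, the maximum of `A 1` and the max-plus identity. -/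
noncomputable def matI (i j : Fin n) : EReal := max (N.A 1 i j) (mpOne i j)

/-- The matrix `C`, the maximum of `A 0` and the negative transpose of `B 0`. -/
noncomputable def matC (i j : Fin n) : EReal := max (N.A 0 i j) (- N.B 0 j i)

/-- The block tridiagonal matrix `M_K`, with `C` on the diagonal, `P` above and `I` below it. -/
noncomputable def M (K : ℕ) (a b : Fin (K + 1) × Fin n) : EReal :=
  if a.1 = b.1 then N.matC a.2 b.2
  else if (b.1 : ℕ) = a.1 + 1 then N.matP a.2 b.2
  else if (a.1 : ℕ) = b.1 + 1 then N.matI a.2 b.2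
  else ⊥

/-- Arc weights of the periodic graph with node set `{rows} × ℤ`: the arc from `(j, z)` to
`(i, z - 1)`, `(i, z + 1)`, `(i, z)` has weight `P i j`, `I i j`, `C i j`. -/
noncomputable def arcW (u v : Fin n × ℤ) : EReal :=
  if v.2 = u.2 - 1 then N.matP v.1 u.1
  else if v.2 = u.2 + 1 then N.matI v.1 u.1
  else if v.2 = u.2 then N.matC v.1 u.1
  else ⊥

/-- The set `S_i` of all pairs `(t, w)` such that `w` is the maximum weight of the paths from
`(i, 0)` to `(i, t)` with at most `n` arcs in the periodic graph. -/
def S (i : Fin n) : Set (ℤ × ℝ) :=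
  {p | IsGreatest {w : ℝ | ∃ r : ℕ, 1 ≤ r ∧ r ≤ n ∧ ∃ ρ : WPath N.arcW r,
    ρ.node 0 = (i, 0) ∧ ρ.node (Fin.last r) = (i, p.1) ∧ ρ.weight = w} p.2}

/-- `R i j` is the maximum weight of the circuits with at most `n ^ 2` arcs in the periodic graph
that pass through row `i` and row `j`, and `-∞` if there are none (the set is finite, because
the circuits start in column 0). -/
noncomputable def R (i j : Fin n) : EReal :=
  sSup {w : EReal | ∃ r : ℕ, 1 ≤ r ∧ r ≤ n ^ 2 ∧ ∃ τ : WPath N.arcW r,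
    (∃ u : Fin n, τ.node 0 = (u, 0) ∧ τ.node (Fin.last r) = (u, 0)) ∧
    (∃ k, (τ.node k).1 = i) ∧ (∃ k, (τ.node k).1 = j) ∧ w = (τ.weight : EReal)}

/-- Data that certify that the graph is not weakly consistent: rows `i`, `j` on a common short
circuit, `(t, w) ∈ S_i` and `(t', w') ∈ S_j` for which the Diophantine system
`y t + y' t' = 0`, `y w + y' w' > 0` is solvable in nonnegative integers. -/
def IsWitness (i j : Fin n) (t : ℤ) (w : ℝ) (t' : ℤ) (w' : ℝ) : Prop :=
  N.R i j ≠ ⊥ ∧ (t, w) ∈ N.S i ∧ (t', w') ∈ N.S j ∧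
  ∃ y y' : ℕ, (y : ℤ) * t + (y' : ℤ) * t' = 0 ∧ 0 < (y : ℝ) * w + (y' : ℝ) * w'

/-- `q = (y, y')` solves `y t + y' t' = 0`, `y w + y' w' + R i j > 0`. -/
def IsSol (i j : Fin n) (t : ℤ) (w : ℝ) (t' : ℤ) (w' : ℝ) (q : ℕ × ℕ) : Prop :=
  (q.1 : ℤ) * t + (q.2 : ℤ) * t' = 0 ∧
  0 < (((q.1 : ℝ) * w + (q.2 : ℝ) * w' : ℝ) : EReal) + N.R i j

end PTEG

/-- The horizon `y |t| + 2 n + 2 ⌊n² / 2⌋ + 1`. -/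
def horizon (n : ℕ) (t : ℤ) (y : ℕ) : ℕ := y * t.natAbs + 2 * n + 2 * (n ^ 2 / 2) + 1

/-! ## Programs with a step count

A unit-cost machine with natural-number registers (numbered by `ℕ`) and two-dimensional arrays
(numbered by `ℕ`) of extended reals, whose cells are addressed through registers.  A program only
mentions finitely many registers and arrays. -/

/-- The contents of the registers and of the arrays. -/
structure MState where
  reg : ℕ → ℕ
  arr : ℕ → ℕ → ℕ → EReal

/-- The cell of array `a` whose row and column are the contents of registers `row` and `col`. -/
structure Cell where
  a : ℕ
  row : ℕ
  col : ℕ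

/-- The content of a cell. -/
def Cell.get (c : Cell) (s : MState) : EReal := s.arr c.a (s.reg c.row) (s.reg c.col)

/-- Write `v` into a cell. -/
noncomputable def Cell.put (c : Cell) (v : EReal) (s : MState) : MState :=
  { s with arr := fun a i j =>
      if a = c.a ∧ i = s.reg c.row ∧ j = s.reg c.col then v else s.arr a i j }

/-- Write `v` into register `x`. -/
def MState.set (s : MState) (x v : ℕ) : MState :=
  { s with reg := fun y => if y = x then v else s.reg y }

/-- Elementary operations; the first argument is the destination. -/
inductive Instr where
  | const (x c : ℕ)
  | copy (x y : ℕ)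
  | add (x y z : ℕ)
  | sub (x y z : ℕ)
  | half (x y : ℕ)
  | vzero (c : Cell)
  | vbot (c : Cell)
  | vcopy (c d : Cell)
  | vneg (c d : Cell)
  | vadd (c d e : Cell)
  | vmax (c d e : Cell)

/-- The effect of an elementary operation. -/
noncomputable def Instr.run : Instr → MState → MState
  | .const x c, s => s.set x c
  | .copy x y, s => s.set x (s.reg y)
  | .add x y z, s => s.set x (s.reg y + s.reg z)
  | .sub x y z, s => s.set x (s.reg y - s.reg z)
  | .half x y, s => s.set x (s.reg y / 2)
  | .vzero c, s => c.put 0 s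
  | .vbot c, s => c.put ⊥ s
  | .vcopy c d, s => c.put (d.get s) s
  | .vneg c d, s => c.put (- d.get s) s
  | .vadd c d e, s => c.put (d.get s + e.get s) s
  | .vmax c d e, s => c.put (max (d.get s) (e.get s)) s

/-- Comparisons of two registers or of two cells. -/
inductive Cond where
  | regLt (x y : ℕ)
  | cellLt (c d : Cell)

/-- The truth of a comparison. -/
def Cond.holds : Cond → MState → Prop
  | .regLt x y, s => s.reg x < s.reg y
  | .cellLt c d, s => c.get s < d.get s

/-- Programs. -/
inductive Prog where
  | skip
  | op (o : Instr)
  | seq (p q : Prog)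
  | ite (b : Cond) (p q : Prog)
  | loop (b : Cond) (p : Prog)

/-- `Exec p s T s'`: program `p`, started in `s`, halts in `s'` after exactly `T` steps, where
every elementary operation and every evaluation of a comparison is one step.
`loop b p` repeats `p` while `b` holds. -/
inductive Exec : Prog → MState → ℕ → MState → Prop where
  | skip (s : MState) : Exec .skip s 1 s
  | op (o : Instr) (s : MState) : Exec (.op o) s 1 (o.run s)
  | seq {p q : Prog} {s s' s'' : MState} {T T' : ℕ} :
      Exec p s T s' → Exec q s' T' s'' → Exec (.seq p q) s (T + T') s''
  | ite_true {b : Cond} {p q : Prog} {s s' : MState} {T : ℕ} :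
      b.holds s → Exec p s T s' → Exec (.ite b p q) s (T + 1) s'
  | ite_false {b : Cond} {p q : Prog} {s s' : MState} {T : ℕ} :
      ¬ b.holds s → Exec q s T s' → Exec (.ite b p q) s (T + 1) s'
  | loop_true {b : Cond} {p : Prog} {s s' s'' : MState} {T T' : ℕ} :
      b.holds s → Exec p s T s' → Exec (.loop b p) s' T' s'' →
      Exec (.loop b p) s (T + T' + 1) s''
  | loop_false {b : Cond} {p : Prog} {s : MState} :
      ¬ b.holds s → Exec (.loop b p) s 1 s

/-! Registers: `0` holds `n`, `1` the search bound, `2` and `3` the ends of the search interval,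
`4` the index `k` under test, `5` the answer of the test.
Arrays `0`, `1`, `2`, `3` hold `A⁰`, `A¹`, `B⁰`, `B¹`. -/

/-- Binary search in `{0, …, bound}`; `test` puts `1` into register `5` if the graph of `M_k`, for
the index `k` in register `4`, has no circuit of positive weight, and `0` otherwise.  The result
is left in register `2`. -/
def binarySearch (test : Prog) : Prog :=
  .seq (.op (.const 2 0)) <|
  .seq (.op (.copy 3 1)) <|
  .loop (.regLt 2 3) <|
    .seq (.op (.add 4 2 3)) <|
    .seq (.op (.half 4 4)) <|
    .seq test <|
    .seq (.op (.const 6 0)) <|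
    .ite (.regLt 6 5)
      (.seq (.op (.const 6 1)) (.op (.add 2 4 6)))
      (.op (.copy 3 4))

/-- The input arrays hold the characteristic matrices of `N`. -/
def PTEG.Loaded {n : ℕ} (N : PTEG n) (s : MState) : Prop :=
  ∀ i j : Fin n, s.arr 0 i j = N.A 0 i j ∧ s.arr 1 i j = N.A 1 i j ∧
    s.arr 2 i j = N.B 0 i j ∧ s.arr 3 i j = N.B 1 i j

/-- The input of the search: `n`, the search bound and the characteristic matrices; all other
registers and cells are zero. -/
noncomputable def PTEG.input {n : ℕ} (N : PTEG n) (bound : ℕ) : MState where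
  reg x := if x = 0 then n else if x = 1 then bound else 0
  arr a i j :=
    if h : i < n ∧ j < n then
      if a = 0 then N.A 0 ⟨i, h.1⟩ ⟨j, h.2⟩
      else if a = 1 then N.A 1 ⟨i, h.1⟩ ⟨j, h.2⟩
      else if a = 2 then N.B 0 ⟨i, h.1⟩ ⟨j, h.2⟩
      else if a = 3 then N.B 1 ⟨i, h.1⟩ ⟨j, h.2⟩
      else 0
    else 0

/-- `test` decides, for every nonempty P-time event graph and every `k`, whether the precedence
graph of `M_k` (which has `n (k + 1)` nodes) is free of circuits of positive weight, in
at most `c (n (k + 1))³` steps, whatever the other registers and cells contain; it preserves the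
input and the registers `0, …, 4`. -/
def DecidesGamma (test : Prog) (c : ℝ) : Prop :=
  ∀ (n : ℕ) (N : PTEG n) (k : ℕ) (s : MState), 0 < n → N.Loaded s → s.reg 0 = n → s.reg 4 = k →
    ∃ (T : ℕ) (s' : MState), Exec test s T s' ∧ (T : ℝ) ≤ c * ((n : ℝ) * (k + 1)) ^ 3 ∧
      (InGamma (N.M k) → s'.reg 5 = 1) ∧ (¬ InGamma (N.M k) → s'.reg 5 = 0) ∧
      (∀ x ≤ 4, s'.reg x = s.reg x) ∧ (∀ a < 4, s'.arr a = s.arr a)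

/-! ## Potentials and the Floyd–Warshall closure -/

/-! Moving each upper bound to the other side turns all constraints into inequalities `M i j + x j ≤
x i`. A consistent trajectory `x 0, …, x K` is thus a finite subeigenvector (a potential) of `M_K`
(`consistentUpTo_iff`). On finitely many nodes, a matrix without entry `⊤` has a potential iff it
has no circuit of positive weight: its powers inherit a potential, and conversely the Floyd–Warshall
closure yields one (`inGamma_iff_exists_isPotential`). Token death is therefore the appearance of a
positive circuit.

Bound: given a solution `(y, y')`, turn `y` times on a circuit of row `i`, walk to row `j` along one
part of a circuit realising `R i j`, turn `y'` times there and walk back. The advances cancel, the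
weight is positive, and the columns fit into `horizon` (`not_consistentUpTo_horizon`).

Existence: by translation invariance a walk is known by its rows and its advance, and closed walks
decompose into cycles that are simple in the rows. Without a witness, cycles of advance zero are
nonpositive, and so is every balanced combination of two cycles of opposite direction. Then all
vectors (advance, weight) of cycles in one strong component lie below a line through the origin
(`exists_slope`), hence so do all closed walks (`Reach.le_slope`), against a positive circuit of
advance zero. The delicate point is `R i j ≠ ⊥`, a common circuit with at most `n ^ 2` arcs
(`SimpleCycle.exists_R_ne_bot`, by the count in `exists_turns`); it needs `2 ≤ n`, and
`Reach.loops_nonpos` settles `n = 1`.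

Algorithm: the test writes `M_k` into memory and runs Floyd–Warshall in place. Bisection is sound
because prefixes of consistent trajectories are consistent. -/

section MaxPlus

variable {ι : Type}

/-- `x` is a (finite) subeigenvector of `A`, i.e. `A ⊗ x ≤ x` in max-plus notation. -/
def IsPotential (A : ι → ι → EReal) (x : ι → ℝ) : Prop :=
  ∀ i j, A i j + (x j : EReal) ≤ (x i : EReal)

/-- One Floyd–Warshall step, which routes through the node `k`. -/
noncomputable def pivot (k : ι) (D : ι → ι → EReal) : ι → ι → EReal :=
  fun i j => max (D i j) (D i k + D k j)

/-- `D` is transitive through every node of `s`, and has no positive diagonal entry in `s`. -/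
def ClosedOn (s : Set ι) (D : ι → ι → EReal) : Prop :=
  ∀ l ∈ s, D l l ≤ 0 ∧ ∀ i j, D i l + D l j ≤ D i j

theorem le_pivot (k : ι) (D : ι → ι → EReal) (i j : ι) : D i j ≤ pivot k D i j := le_max_left _ _

/-- The pivot row and, below, the pivot column do not change; this is what makes the in-place update
of the program correct. -/
theorem pivot_row {k : ι} {D : ι → ι → EReal} (hk : D k k ≤ 0) (j : ι) :
    pivot k D k j = D k j :=
  max_eq_left (by simpa using add_le_add_left hk (D k j))

theorem pivot_col {k : ι} {D : ι → ι → EReal} (hk : D k k ≤ 0) (i : ι) :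
    pivot k D i k = D i k :=
  max_eq_left (by simpa using add_le_add_right hk (D i k))

theorem EReal.max_add_max_le {a b c d e : EReal} (h1 : a + c ≤ e) (h2 : a + d ≤ e)
    (h3 : b + c ≤ e) (h4 : b + d ≤ e) : max a b + max c d ≤ e := by
  rcases max_choice a b with h | h <;> rcases max_choice c d with h' | h' <;> rw [h, h'] <;>
    assumption

theorem ClosedOn.pivot {s : Set ι} {D : ι → ι → EReal} (h : ClosedOn s D) {k : ι}
    (hk : D k k ≤ 0) : ClosedOn (insert k s) (pivot k D) := by
  rintro l (rfl | hl)
  · refine ⟨by rw [pivot_row hk]; exact hk, fun i j => ?_⟩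
    rw [pivot_row hk, pivot_col hk]
    exact le_max_right _ _
  · obtain ⟨h0, h1⟩ := h l hl
    refine ⟨max_le h0 ?_, fun i j => ?_⟩
    · rw [add_comm]
      exact (h1 k k).trans hk
    · refine EReal.max_add_max_le ((h1 i j).trans (le_max_left _ _)) ?_ ?_ ?_
      · rw [← add_assoc]
        exact (add_le_add_left (h1 i k) _).trans (le_max_right _ _)
      · rw [add_assoc]
        exact (add_le_add_right (h1 k j) _).trans (le_max_right _ _)
      -- The detour `k → l → k` costs at most `D k k`, by transitivity through `l`, and hence at
      -- most `0`.
      · calc D i k + D k l + (D l k + D k j) = D i k + (D k l + D l k) + D k j := by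
              simp only [add_assoc]
          _ ≤ D i k + D k k + D k j := by gcongr; exact h1 k k
          _ ≤ D i k + 0 + D k j := by gcongr
          _ ≤ _ := by rw [add_zero]; exact le_max_right _ _

theorem pivot_ne_top {k : ι} {D : ι → ι → EReal} (h : ∀ i j, D i j ≠ ⊤) (i j : ι) :
    pivot k D i j ≠ ⊤ := by
  rcases max_choice (D i j) (D i k + D k j) with h' | h'
  · rw [pivot, h']; exact h i j
  · rw [pivot, h']; exact EReal.add_ne_top (h _ _) (h _ _)

theorem IsPotential.pivot {D : ι → ι → EReal} {x : ι → ℝ} (h : IsPotential D x) (k : ι) :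
    IsPotential (pivot k D) x := by
  intro i j
  rcases max_choice (D i j) (D i k + D k j) with h' | h'
  · rw [_root_.pivot, h']; exact h i j
  · rw [_root_.pivot, h', add_assoc]
    exact (add_le_add_right (h k j) _).trans (h i k)

theorem IsPotential.mono {A D : ι → ι → EReal} {x : ι → ℝ} (h : IsPotential D x)
    (hA : ∀ i j, A i j ≤ D i j) : IsPotential A x :=
  fun i j => (add_le_add_left (hA i j) _).trans (h i j)

theorem IsPotential.diag {D : ι → ι → EReal} {x : ι → ℝ} (h : IsPotential D x) (i : ι) :
    D i i ≤ 0 := by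
  have := h i i
  by_contra! hlt
  exact absurd this (not_le.2 (by simpa using EReal.add_lt_add_right_coe hlt (x i)))

theorem IsPotential.mpPow [DecidableEq ι] {A : ι → ι → EReal} {x : ι → ℝ} (h : IsPotential A x)
    (r : ℕ) : IsPotential (mpPow A r) x := by
  induction r with
  | zero =>
    intro i j
    by_cases hij : i = j
    · simp [_root_.mpPow, mpOne, hij]
    · simp [_root_.mpPow, mpOne, hij]
  | succ r ih =>
    intro i j
    have : Nonempty ι := ⟨i⟩
    show (⨆ k, _root_.mpPow A r i k + A k j) + (x j : EReal) ≤ _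
    -- Adding a real number is invertible, so it is moved to the right before the supremum is
    -- bounded termwise.
    rw [← EReal.le_sub_iff_add_le (by simp) (by simp)]
    refine iSup_le fun k => ?_
    rw [EReal.le_sub_iff_add_le (by simp) (by simp), add_assoc]
    exact (add_le_add_right (h k j) _).trans (ih i k)

theorem IsPotential.inGamma [DecidableEq ι] {A : ι → ι → EReal} {x : ι → ℝ}
    (h : IsPotential A x) : InGamma A := fun r _ i => (h.mpPow r).diag i

theorem mpPow_one [DecidableEq ι] (A : ι → ι → EReal) (i j : ι) : A i j ≤ mpPow A 1 i j := by
  show _ ≤ ⨆ k, mpOne i k + A k j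
  exact le_iSup_of_le i (by simp [mpOne])

theorem mpPow_add_le [DecidableEq ι] [Finite ι] (A : ι → ι → EReal) (r s : ℕ) (i k j : ι) :
    mpPow A r i k + mpPow A s k j ≤ mpPow A (r + s) i j := by
  induction s generalizing j with
  | zero =>
    by_cases h : k = j
    · simp [mpPow, mpOne, h]
    · simp [mpPow, mpOne, h]
  | succ s ih =>
    have : Nonempty ι := ⟨i⟩
    -- Over a finite index type the supremum is attained, which replaces distributivity of addition
    -- over it.
    obtain ⟨m, hm⟩ := exists_eq_ciSup_of_finite (f := fun m => mpPow A s k m + A m j)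
    have h1 : mpPow A (s + 1) k j = mpPow A s k m + A m j := hm.symm
    rw [h1, ← add_assoc, ← add_assoc]
    exact (add_le_add_left (ih m) _).trans
      (le_iSup (fun m => mpPow A (r + s) i m + A m j) m)

/-- The row maxima of a closed matrix, cut off below at `0`, form a potential, since `D i j + D j m
≤ D i m`. The cutoff makes them finite. -/
theorem ClosedOn.exists_isPotential [Fintype ι] {D : ι → ι → EReal}
    (h : ClosedOn Set.univ D) (htop : ∀ i j, D i j ≠ ⊤) : ∃ x, IsPotential D x := by
  set y : ι → EReal := fun i => max 0 (Finset.univ.sup (D i)) with hy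
  have hlt : ∀ i, y i ≠ ⊤ := fun i => by
    refine (max_lt (by simp) ?_).ne
    rw [Finset.sup_lt_iff (by simp)]
    exact fun j _ => lt_top_iff_ne_top.2 (htop i j)
  have hbot : ∀ i, y i ≠ ⊥ := fun i =>
    (lt_of_lt_of_le (by simp) (le_max_left 0 (Finset.univ.sup (D i)))).ne'
  refine ⟨fun i => (y i).toReal, fun i j => ?_⟩
  rw [EReal.coe_toReal (hlt i) (hbot i), EReal.coe_toReal (hlt j) (hbot j)]
  have hle : ∀ m, D i m ≤ y i := fun m =>
    (Finset.le_sup (f := D i) (Finset.mem_univ m)).trans (le_max_right _ _)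
  rcases max_choice 0 (Finset.univ.sup (D j)) with h' | h'
  · simp only [hy, h', add_zero]
    exact hle j
  · obtain ⟨m, -, hm⟩ := Finset.exists_mem_eq_sup Finset.univ ⟨j, Finset.mem_univ j⟩ (D j)
    have : y j = D j m := by rw [← hm, ← h']
    rw [this]
    exact ((h j trivial).2 i m).trans (hle m)

theorem InGamma.exists_isPotential [DecidableEq ι] [Fintype ι] {A : ι → ι → EReal}
    (h : InGamma A) (htop : ∀ i j, A i j ≠ ⊤) : ∃ x, IsPotential A x := by
  -- Bounding each entry by an entry of a positive power of `A` keeps every pivot diagonal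
  -- nonpositive under `InGamma`.
  have key : ∀ s : Finset ι, ∃ D : ι → ι → EReal, (∀ i j, A i j ≤ D i j) ∧ (∀ i j, D i j ≠ ⊤) ∧
      ClosedOn (s : Set ι) D ∧ ∀ i j, ∃ r, 1 ≤ r ∧ D i j ≤ mpPow A r i j := by
    intro s
    induction s using Finset.induction_on with
    | empty =>
      exact ⟨A, fun _ _ => le_rfl, htop, by simp [ClosedOn], fun i j => ⟨1, le_rfl, mpPow_one A i j⟩⟩
    | insert k s _ ih =>
      obtain ⟨D, h1, h2, h3, h4⟩ := ih
      refine ⟨pivot k D, fun i j => (h1 i j).trans (le_pivot k D i j), pivot_ne_top h2, ?_, ?_⟩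
      · rw [Finset.coe_insert]
        obtain ⟨r, hr, hle⟩ := h4 k k
        exact h3.pivot (hle.trans (h r hr k))
      · intro i j
        rcases max_choice (D i j) (D i k + D k j) with h' | h'
        · rw [pivot, h']; exact h4 i j
        · rw [pivot, h']
          obtain ⟨r, hr, hle⟩ := h4 i k
          obtain ⟨r', -, hle'⟩ := h4 k j
          exact ⟨r + r', by omega, (add_le_add hle hle').trans (mpPow_add_le A r r' i k j)⟩
  obtain ⟨D, h1, h2, h3, -⟩ := key Finset.univ
  rw [Finset.coe_univ] at h3
  obtain ⟨x, hx⟩ := h3.exists_isPotential h2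
  exact ⟨x, hx.mono h1⟩

theorem inGamma_iff_exists_isPotential [DecidableEq ι] [Fintype ι] {A : ι → ι → EReal}
    (htop : ∀ i j, A i j ≠ ⊤) : InGamma A ↔ ∃ x, IsPotential A x :=
  ⟨fun h => h.exists_isPotential htop, fun ⟨_, h⟩ => h.inGamma⟩

end MaxPlus

/-! ## Consistent trajectories are potentials -/

theorem EReal.neg_add_coe_le_iff (b : EReal) (x y : ℝ) :
    -b + (x : EReal) ≤ y ↔ (x : EReal) ≤ b + y := by
  induction b with
  | bot => simp
  | top => simp
  | coe b =>
    norm_cast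
    constructor <;> intro h <;> linarith

theorem EReal.max_add_coe_le_iff (a b : EReal) (x y : ℝ) :
    max a b + (x : EReal) ≤ y ↔ a + (x : EReal) ≤ y ∧ b + (x : EReal) ≤ y := by
  rw [← EReal.le_sub_iff_add_le (by simp) (by simp), max_le_iff,
    EReal.le_sub_iff_add_le (by simp) (by simp), EReal.le_sub_iff_add_le (by simp) (by simp)]

theorem mpOne_add_coe_le_iff {ι : Type} [DecidableEq ι] (i j : ι) (x y : ℝ) :
    mpOne i j + (x : EReal) ≤ y ↔ (i = j → x ≤ y) := by
  by_cases h : i = j <;> simp [mpOne, h]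

namespace PTEG

variable {n : ℕ} (N : PTEG n)

/-- The supremum in `A` and the infimum in `B` range over at most one place, so they are the window
bounds themselves. -/
theorem subsingleton_places (μ : Fin 2) (i j : Fin n) :
    Subsingleton {p : N.Place // N.marking p = μ ∧ N.up p = j ∧ N.down p = i} := by
  constructor
  rintro ⟨p, rfl, rfl, rfl⟩ ⟨q, h1, h2, h3⟩
  exact Subtype.ext (N.simple (by simp [h1, h2, h3]))

theorem A_ne_top (μ : Fin 2) (i j : Fin n) : N.A μ i j ≠ ⊤ := by
  have := N.subsingleton_places μ i j
  rcases isEmpty_or_nonempty {p : N.Place // N.marking p = μ ∧ N.up p = j ∧ N.down p = i} with h | ⟨⟨p⟩⟩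
  · simp [A]
  · rw [A, ciSup_subsingleton p]; simp

theorem B_nonneg (μ : Fin 2) (i j : Fin n) : 0 ≤ N.B μ i j :=
  le_iInf fun _ => EReal.coe_ennreal_nonneg _

/-- Serves only the net with a single transition, through `Reach.loops_nonpos`. -/
theorem A_le_B (μ : Fin 2) (i j : Fin n) : N.A μ i j ≤ N.B μ i j := by
  have := N.subsingleton_places μ i j
  rcases isEmpty_or_nonempty {p : N.Place // N.marking p = μ ∧ N.up p = j ∧ N.down p = i} with h | ⟨⟨p⟩⟩
  · simp [A]
  · rw [A, B, ciSup_subsingleton p, ciInf_subsingleton p]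
    rw [← EReal.coe_nnreal_eq_coe_real]
    exact EReal.coe_ennreal_le_coe_ennreal_iff.2 (N.lo_le_hi p.1)

theorem neg_B_ne_top (μ : Fin 2) (i j : Fin n) : -N.B μ i j ≠ ⊤ := by
  rw [Ne, EReal.neg_eq_top_iff]
  exact (lt_of_lt_of_le (by simp) (N.B_nonneg μ i j)).ne'

theorem matP_ne_top (i j : Fin n) : N.matP i j ≠ ⊤ := N.neg_B_ne_top 1 j i

theorem matI_ne_top (i j : Fin n) : N.matI i j ≠ ⊤ := by
  refine (max_lt (lt_top_iff_ne_top.2 (N.A_ne_top 1 i j)) ?_).ne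
  by_cases h : i = j <;> simp [mpOne, h]

theorem matC_ne_top (i j : Fin n) : N.matC i j ≠ ⊤ :=
  (max_lt (lt_top_iff_ne_top.2 (N.A_ne_top 0 i j)) (lt_top_iff_ne_top.2 (N.neg_B_ne_top 0 j i))).ne

theorem M_ne_top (K : ℕ) (a b : Fin (K + 1) × Fin n) : N.M K a b ≠ ⊤ := by
  unfold M
  split_ifs
  · exact N.matC_ne_top _ _
  · exact N.matP_ne_top _ _
  · exact N.matI_ne_top _ _
  · simp

/-- Potentials of `M_K`, written as functions of the column and the row, satisfy the three families
of inequalities given by the blocks of `M_K`. -/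
theorem isPotential_M_iff (K : ℕ) (x : ℕ → Fin n → ℝ) :
    IsPotential (N.M K) (fun a => x a.1 a.2) ↔
      (∀ k ≤ K, ∀ i j, N.matC i j + (x k j : EReal) ≤ x k i) ∧
      (∀ k < K, ∀ i j, N.matP i j + (x (k + 1) j : EReal) ≤ x k i) ∧
      (∀ k < K, ∀ i j, N.matI i j + (x k j : EReal) ≤ x (k + 1) i) := by
  constructor
  · intro h
    refine ⟨fun k hk i j => ?_, fun k hk i j => ?_, fun k hk i j => ?_⟩
    · simpa [M, Fin.ext_iff] using h (⟨k, by omega⟩, i) (⟨k, by omega⟩, j)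
    · simpa [M, Fin.ext_iff] using h (⟨k, by omega⟩, i) (⟨k + 1, by omega⟩, j)
    · simpa [M, Fin.ext_iff, show ¬ k = k + 1 + 1 by omega] using h (⟨k + 1, by omega⟩, i) (⟨k, by omega⟩, j)
  · rintro ⟨hC, hP, hI⟩ ⟨⟨k, hk⟩, i⟩ ⟨⟨l, hl⟩, j⟩
    unfold M
    simp only [Fin.mk.injEq]
    split_ifs with h1 h2 h3
    · subst h1; exact hC k (by omega) i j
    · subst h2; exact hP k (by omega) i j
    · subst h3; exact hI l (by omega) i j
    · simp

/-- An upper bound `x ≤ B + y` is the lower bound `-B + x ≤ y`, which explains the transposes in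
`matP` and `matC`; the identity inside `matI` encodes that firing times are nondecreasing. -/
theorem consistentUpTo_iff (K : ℕ) (x : ℕ → Fin n → ℝ) :
    N.ConsistentUpTo K x ↔ IsPotential (N.M K) (fun a => x a.1 a.2) := by
  rw [isPotential_M_iff]
  simp only [ConsistentUpTo, matC, matP, matI, EReal.max_add_coe_le_iff, EReal.neg_add_coe_le_iff,
    mpOne_add_coe_le_iff, iSup_le_iff, le_iInf_iff]
  constructor
  · rintro ⟨h0, h1, h2⟩
    refine ⟨fun k hk i j => ⟨(h0 k hk i).1 j, (h0 k hk j).2 i⟩, fun k hk i j => (h1 k hk j).2 i,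
      fun k hk i j => ⟨(h1 k hk i).1 j, ?_⟩⟩
    rintro rfl
    exact h2 k hk i
  · rintro ⟨hC, hP, hI⟩
    exact ⟨fun k hk i => ⟨fun j => (hC k hk i j).1, fun j => (hC k hk j i).2⟩,
      fun k hk i => ⟨fun j => (hI k hk i j).1, fun j => hP k hk j i⟩,
      fun k hk i => (hI k hk i i).2 rfl⟩

theorem inGamma_M_iff (K : ℕ) : InGamma (N.M K) ↔ ∃ x, N.ConsistentUpTo K x := by
  rw [inGamma_iff_exists_isPotential (N.M_ne_top K)]
  constructor
  · rintro ⟨x, hx⟩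
    refine ⟨fun k i => if h : k < K + 1 then x (⟨k, h⟩, i) else 0, ?_⟩
    rw [consistentUpTo_iff]
    simpa only [Fin.is_lt, dif_pos, Fin.eta] using hx
  · rintro ⟨x, hx⟩
    exact ⟨_, (N.consistentUpTo_iff K x).1 hx⟩

theorem ConsistentUpTo.mono {N : PTEG n} {K L : ℕ} {x : ℕ → Fin n → ℝ}
    (h : N.ConsistentUpTo L x) (hKL : K ≤ L) : N.ConsistentUpTo K x :=
  ⟨fun k hk => h.1 k (hk.trans hKL), fun k hk => h.2.1 k (hk.trans_le hKL),
    fun k hk => h.2.2 k (hk.trans_le hKL)⟩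

/-- The first token death, the first `M_k` with a circuit of positive weight, and the maximal
number of consistent firings are the same. -/
theorem isFirstDeath_and {k : ℕ} (h : IsLeast {K : ℕ | ¬ InGamma (N.M K)} k) :
    N.IsFirstDeath k ∧ IsGreatest {m : ℕ | N.AdmitsFirings m} k := by
  have h1 : N.IsFirstDeath k := by
    unfold IsFirstDeath
    simpa only [inGamma_M_iff] using h
  refine ⟨h1, ?_, ?_⟩
  · cases k with
    | zero => trivial
    | succ K =>
      by_contra hK
      have := h1.2 hK
      omega
  · intro m hm
    cases m with
    | zero => omega
    | succ K =>
      by_contra! hK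
      obtain ⟨x, hx⟩ := hm
      exact h1.1 ⟨x, hx.mono (by omega)⟩

end PTEG

/-! ## Walks in the periodic graph, up to translation -/

namespace PTEG

variable {n : ℕ} (N : PTEG n)

/-- Translation invariance allows a walk to be recorded by its rows and its advance alone, as in
`Reach`. -/
theorem arcW_translate (u v : Fin n × ℤ) :
    N.arcW (u.1, 0) (v.1, v.2 - u.2) = N.arcW u v := by
  unfold arcW
  congr 1
  · simp only [eq_iff_iff]; omega
  congr 1
  · simp only [eq_iff_iff]; omega
  congr 1
  simp only [eq_iff_iff]; omega

theorem arcW_ne_top (u v : Fin n × ℤ) : N.arcW u v ≠ ⊤ := by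
  unfold arcW
  split_ifs
  · exact N.matP_ne_top _ _
  · exact N.matI_ne_top _ _
  · exact N.matC_ne_top _ _
  · simp

theorem abs_le_one_of_arcW {i j : Fin n} {d : ℤ} (h : N.arcW (i, 0) (j, d) ≠ ⊥) : |d| ≤ 1 := by
  by_contra! hd
  apply h
  have h2 := lt_abs.1 hd
  unfold arcW
  rw [if_neg, if_neg, if_neg] <;> simp only <;> omega

/-- `N.Reach r i j t w`: the periodic graph has a path with `r` arcs and weight `w` from row `i`
to row `j` that advances by `t` columns. -/
inductive Reach : ℕ → Fin n → Fin n → ℤ → ℝ → Prop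
  | nil (i : Fin n) : Reach 0 i i 0 0
  | cons {r : ℕ} {i k j : Fin n} {d t : ℤ} {w : ℝ} :
      N.arcW (i, 0) (k, d) ≠ ⊥ → Reach r k j t w →
      Reach (r + 1) i j (d + t) ((N.arcW (i, 0) (k, d)).toReal + w)

variable {N}

theorem Reach.of_eq {r r' : ℕ} {i j : Fin n} {t t' : ℤ} {w w' : ℝ} (h : N.Reach r i j t w)
    (hr : r = r') (ht : t = t') (hw : w = w') : N.Reach r' i j t' w' := by
  subst hr ht hw; exact h

theorem Reach.single {i j : Fin n} {d : ℤ} (h : N.arcW (i, 0) (j, d) ≠ ⊥) :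
    N.Reach 1 i j d (N.arcW (i, 0) (j, d)).toReal :=
  (Reach.cons h (Reach.nil j)).of_eq rfl (add_zero _) (add_zero _)

theorem Reach.append {r s : ℕ} {i j k : Fin n} {t u : ℤ} {w v : ℝ} (h : N.Reach r i j t w)
    (h' : N.Reach s j k u v) : N.Reach (r + s) i k (t + u) (w + v) := by
  induction h with
  | nil i => exact h'.of_eq (by omega) (by omega) (by ring)
  | cons ha _ ih => exact (Reach.cons ha (ih h')).of_eq (by omega) (by omega) (by ring)

theorem Reach.iterate {r : ℕ} {i : Fin n} {t : ℤ} {w : ℝ} (h : N.Reach r i i t w) (m : ℕ) :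
    N.Reach (m * r) i i (m * t) (m * w) := by
  induction m with
  | zero => exact (Reach.nil i).of_eq (by simp) (by simp) (by simp)
  | succ m ih =>
    exact (ih.append h).of_eq (by ring) (by push_cast; ring) (by push_cast; ring)

theorem Reach.abs_le {r : ℕ} {i j : Fin n} {t : ℤ} {w : ℝ} (h : N.Reach r i j t w) :
    |t| ≤ r := by
  induction h with
  | nil i => simp
  | cons ha _ ih =>
    have := N.abs_le_one_of_arcW ha
    push_cast
    exact (abs_add_le _ _).trans (by omega)

theorem Reach.eq_of_zero {i j : Fin n} {t : ℤ} {w : ℝ} (h : N.Reach 0 i j t w) :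
    i = j ∧ t = 0 ∧ w = 0 := by
  cases h; simp

/-- The node sequence of a walk. -/
theorem Reach.exists_nodes {r : ℕ} {i j : Fin n} {t : ℤ} {w : ℝ} (h : N.Reach r i j t w) (z : ℤ) :
    ∃ v : ℕ → Fin n × ℤ, v 0 = (i, z) ∧ v r = (j, z + t) ∧
      (∀ k < r, N.arcW (v k) (v (k + 1)) ≠ ⊥) ∧
      ∑ k ∈ Finset.range r, (N.arcW (v k) (v (k + 1))).toReal = w := by
  induction h generalizing z with
  | nil i => exact ⟨fun _ => (i, z), rfl, by simp, by simp, by simp⟩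
  | @cons r i k j d t w ha _ ih =>
    obtain ⟨v, h0, hr, hv, hw⟩ := ih (z + d)
    have h1 : N.arcW (i, z) (k, z + d) = N.arcW (i, 0) (k, d) := by
      rw [← arcW_translate]; simp
    refine ⟨fun m => m.casesOn (i, z) v, rfl, ?_, ?_, ?_⟩
    · simp [hr, add_assoc]
    · rintro (_ | m) hm
      · simpa [h0, h1] using ha
      · exact hv m (by omega)
    · rw [Finset.sum_range_succ']
      simp only [h0, hw]
      rw [add_comm, ← h1]
      rfl

/-- Every segment of a node sequence is a walk. -/
theorem reach_of_nodes (v : ℕ → Fin n × ℤ) (a m : ℕ)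
    (h : ∀ k, a ≤ k → k < a + m → N.arcW (v k) (v (k + 1)) ≠ ⊥) :
    N.Reach m (v a).1 (v (a + m)).1 ((v (a + m)).2 - (v a).2)
      (∑ k ∈ Finset.Ico a (a + m), (N.arcW (v k) (v (k + 1))).toReal) := by
  induction m with
  | zero => exact (Reach.nil (v a).1).of_eq rfl (by simp) (by simp)
  | succ m ih =>
    have h1 := ih fun k h1 h2 => h k h1 (by omega)
    have h2 := h (a + m) (by omega) (by omega)
    rw [← arcW_translate] at h2
    refine (h1.append (Reach.single h2)).of_eq rfl (by rw [← add_assoc]; ring) ?_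
    rw [arcW_translate, ← add_assoc, Finset.sum_Ico_succ_top (by omega)]

/-- The node sequence of a `WPath`, extended constantly. -/
def _root_.WPath.seq {V : Type} {W : V → V → EReal} {r : ℕ} (ρ : WPath W r) (k : ℕ) : V :=
  ρ.node ⟨min k r, by omega⟩

theorem _root_.WPath.seq_coe {V : Type} {W : V → V → EReal} {r : ℕ} (ρ : WPath W r)
    (k : Fin (r + 1)) : ρ.seq k = ρ.node k := by
  unfold WPath.seq
  congr 1
  ext
  simp only
  omega

theorem _root_.WPath.seq_arc {V : Type} {W : V → V → EReal} {r : ℕ} (ρ : WPath W r)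
    {k : ℕ} (hk : k < r) : W (ρ.seq k) (ρ.seq (k + 1)) ≠ ⊥ := by
  have := ρ.arc ⟨k, hk⟩
  rwa [← WPath.seq_coe, ← WPath.seq_coe] at this

theorem _root_.WPath.weight_eq {V : Type} {W : V → V → EReal} {r : ℕ} (ρ : WPath W r) :
    ρ.weight = ∑ k ∈ Finset.range r, (W (ρ.seq k) (ρ.seq (k + 1))).toReal := by
  rw [Finset.sum_range, WPath.weight]
  refine Finset.sum_congr rfl fun k _ => ?_
  rw [← WPath.seq_coe, ← WPath.seq_coe]
  rfl

theorem reach_iff_wPath {r : ℕ} {i j : Fin n} {t : ℤ} {w : ℝ} :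
    N.Reach r i j t w ↔ ∃ ρ : WPath N.arcW r,
      ρ.node 0 = (i, 0) ∧ ρ.node (Fin.last r) = (j, t) ∧ ρ.weight = w := by
  constructor
  · intro h
    obtain ⟨v, h0, hr, hv, hw⟩ := h.exists_nodes 0
    refine ⟨⟨fun k => v k, fun k => by simpa using hv k k.2⟩, by simpa using h0,
      by simpa using hr, ?_⟩
    rw [← hw, Finset.sum_range]
    rfl
  · rintro ⟨ρ, h0, hr, rfl⟩
    have h := reach_of_nodes (N := N) ρ.seq 0 r fun k _ hk => ρ.seq_arc (by omega)
    have h1 := ρ.seq_coe 0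
    have h2 := ρ.seq_coe (Fin.last r)
    simp only [Fin.coe_ofNat_eq_mod, Nat.zero_mod, Fin.val_last] at h1 h2
    rw [zero_add, h1, h2, h0, hr] at h
    exact h.of_eq rfl (by simp) (by rw [WPath.weight_eq, Finset.range_eq_Ico])

/-- An arc moves by at most one column, so up to translation there are finitely many walks of given
length. Hence the maxima in `S` and `R` are attained. -/
theorem finite_reach (r : ℕ) :
    {p : Fin n × Fin n × ℤ × ℝ | N.Reach r p.1 p.2.1 p.2.2.1 p.2.2.2}.Finite := by
  induction r with
  | zero =>
    refine (Set.finite_range fun i : Fin n => (i, i, (0 : ℤ), (0 : ℝ))).subset ?_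
    rintro ⟨i, j, t, w⟩ h
    obtain ⟨rfl, rfl, rfl⟩ : i = j ∧ t = 0 ∧ w = 0 := Reach.eq_of_zero h
    exact ⟨_, rfl⟩
  | succ r ih =>
    refine (((Set.finite_univ (α := Fin n)).prod ((Set.finite_Icc (-1 : ℤ) 1).prod ih)).image
      fun q => (q.1, q.2.2.2.1, q.2.1 + q.2.2.2.2.1,
        (N.arcW (q.1, 0) (q.2.2.1, q.2.1)).toReal + q.2.2.2.2.2)).subset ?_
    rintro ⟨i, j, t, w⟩ h
    simp only [Set.mem_ofPred_eq] at h
    cases h with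
    | @cons _ _ k _ d t w ha h =>
      exact ⟨(i, d, k, j, t, w), ⟨trivial, abs_le.1 (N.abs_le_one_of_arcW ha), h⟩, rfl⟩

theorem finite_reach_le (L : ℕ) :
    {p : Fin n × Fin n × ℤ × ℝ | ∃ r ≤ L, N.Reach r p.1 p.2.1 p.2.2.1 p.2.2.2}.Finite := by
  refine ((Set.finite_Iic L).biUnion fun r _ => finite_reach (N := N) r).subset ?_
  rintro p ⟨r, hr, h⟩
  exact Set.mem_biUnion hr h

theorem mem_S_iff {i : Fin n} {t : ℤ} {w : ℝ} :
    (t, w) ∈ N.S i ↔ IsGreatest {w | ∃ r, 1 ≤ r ∧ r ≤ n ∧ N.Reach r i i t w} w := by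
  simp only [S, reach_iff_wPath, Set.mem_ofPred_eq]

theorem exists_reach_of_mem_S {i : Fin n} {t : ℤ} {w : ℝ} (h : (t, w) ∈ N.S i) :
    ∃ r, 1 ≤ r ∧ r ≤ n ∧ N.Reach r i i t w := (mem_S_iff.1 h).1

theorem Reach.exists_mem_S {r : ℕ} {i : Fin n} {t : ℤ} {w : ℝ} (h : N.Reach r i i t w)
    (h1 : 1 ≤ r) (hn : r ≤ n) : ∃ w' ≥ w, (t, w') ∈ N.S i := by
  have hfin : {w | ∃ r, 1 ≤ r ∧ r ≤ n ∧ N.Reach r i i t w}.Finite := by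
    refine ((finite_reach_le (N := N) n).image fun p => p.2.2.2).subset ?_
    rintro w ⟨r, -, hr, h⟩
    exact ⟨(i, i, t, w), ⟨r, hr, h⟩, rfl⟩
  have hmem : w ∈ {w | ∃ r, 1 ≤ r ∧ r ≤ n ∧ N.Reach r i i t w} := ⟨r, h1, hn, h⟩
  obtain ⟨w', hw', hmax⟩ := hfin.exists_le_maximal hmem
  refine ⟨w', hw', mem_S_iff.2 ⟨hmax.1, fun v hv => ?_⟩⟩
  rcases le_total v w' with hle | hle
  · exact hle
  · exact hmax.2 hv hle

/-- A circuit of `R i j`, cut at the rows `i` and `j`. -/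
theorem exists_reach_of_R {i j : Fin n} (h : N.R i j ≠ ⊥) :
    ∃ (r s : ℕ) (d : ℤ) (w v : ℝ), r + s ≤ n ^ 2 ∧ N.Reach r i j d w ∧ N.Reach s j i (-d) v ∧
      N.R i j = ((w + v : ℝ) : EReal) := by
  set X : Set EReal := {w : EReal | ∃ r : ℕ, 1 ≤ r ∧ r ≤ n ^ 2 ∧ ∃ τ : WPath N.arcW r,
    (∃ u : Fin n, τ.node 0 = (u, 0) ∧ τ.node (Fin.last r) = (u, 0)) ∧
    (∃ k, (τ.node k).1 = i) ∧ (∃ k, (τ.node k).1 = j) ∧ w = (τ.weight : EReal)} with hX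
  have hR : N.R i j = sSup X := rfl
  have hfin : X.Finite := by
    refine ((finite_reach_le (N := N) (n ^ 2)).image fun p => ((p.2.2.2 : ℝ) : EReal)).subset ?_
    rintro w ⟨r, -, hr, τ, ⟨u, h0, h1⟩, -, -, rfl⟩
    exact ⟨(u, u, 0, τ.weight), ⟨r, hr, reach_iff_wPath.2 ⟨τ, h0, h1, rfl⟩⟩, rfl⟩
  have hne : X.Nonempty := by
    by_contra hemp
    rw [Set.not_nonempty_iff_eq_empty] at hemp
    rw [hR, hemp, sSup_empty] at h
    exact h rfl
  obtain ⟨r, -, hr, τ, ⟨u, h0, h1⟩, ⟨a, rfl⟩, ⟨b, rfl⟩, hw⟩ := hne.csSup_mem hfin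
  rw [hR, hw, τ.weight_eq, ← τ.seq_coe a, ← τ.seq_coe b]
  have hseg : ∀ p q : ℕ, p ≤ q → q ≤ r → N.Reach (q - p) (τ.seq p).1 (τ.seq q).1
      ((τ.seq q).2 - (τ.seq p).2)
      (∑ k ∈ Finset.Ico p q, (N.arcW (τ.seq k) (τ.seq (k + 1))).toReal) := by
    intro p q hpq hqr
    have := reach_of_nodes (N := N) τ.seq p (q - p) fun k _ hk => τ.seq_arc (by omega)
    rwa [Nat.add_sub_cancel' hpq] at this
  have e0 : τ.seq 0 = (u, 0) := by rw [← h0]; exact τ.seq_coe 0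
  have e1 : τ.seq r = (u, 0) := by rw [← h1]; exact τ.seq_coe (Fin.last r)
  have ha := a.2
  have hb := b.2
  have hsum : ∀ p q : ℕ, p ≤ q → q ≤ r →
      ∑ k ∈ Finset.range r, (N.arcW (τ.seq k) (τ.seq (k + 1))).toReal =
      ∑ k ∈ Finset.Ico p q, (N.arcW (τ.seq k) (τ.seq (k + 1))).toReal +
      (∑ k ∈ Finset.Ico q r, (N.arcW (τ.seq k) (τ.seq (k + 1))).toReal +
      ∑ k ∈ Finset.Ico 0 p, (N.arcW (τ.seq k) (τ.seq (k + 1))).toReal) := by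
    intro p q hpq hqr
    rw [Finset.range_eq_Ico, ← Finset.sum_Ico_consecutive _ (Nat.zero_le p) (hpq.trans hqr),
      ← Finset.sum_Ico_consecutive _ hpq hqr]
    ring
  -- The complementary part of the circuit passes through its base point `u`.
  have hout : ∀ p q : ℕ, p ≤ q → q ≤ r → N.Reach (r - q + p) (τ.seq q).1 (τ.seq p).1
      (-((τ.seq q).2 - (τ.seq p).2))
      (∑ k ∈ Finset.Ico q r, (N.arcW (τ.seq k) (τ.seq (k + 1))).toReal +
      ∑ k ∈ Finset.Ico 0 p, (N.arcW (τ.seq k) (τ.seq (k + 1))).toReal) := by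
    intro p q hpq hqr
    have g1 := hseg q r hqr le_rfl
    have g2 := hseg 0 p (Nat.zero_le p) (hpq.trans hqr)
    rw [e1] at g1
    rw [e0] at g2
    exact (g1.append g2).of_eq (by omega) (by simp only; ring) rfl
  rcases le_total (a : ℕ) b with hab | hab
  · refine ⟨_, _, _, _, _, ?_, hseg a b hab (by omega), hout a b hab (by omega), ?_⟩
    · omega
    · rw [hsum a b hab (by omega)]
  · refine ⟨_, _, _, _, _, ?_, hout b a hab (by omega),
      (hseg b a hab (by omega)).of_eq rfl (by ring) rfl, ?_⟩
    · omega
    · rw [hsum b a hab (by omega), add_comm]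

/-- Two walks of opposite advance glue to a circuit based at `(i, 0)`; its weight plays no role. -/
theorem R_ne_bot {i j : Fin n} {r s : ℕ} {d : ℤ} {w v : ℝ} (h : N.Reach r i j d w)
    (h' : N.Reach s j i (-d) v) (h1 : 1 ≤ r + s) (hn : r + s ≤ n ^ 2) : N.R i j ≠ ⊥ := by
  obtain ⟨f, f0, f1, hf, -⟩ := h.exists_nodes 0
  obtain ⟨g, g0, g1, hg, -⟩ := h'.exists_nodes d
  let v : ℕ → Fin n × ℤ := fun k => if k ≤ r then f k else g (k - r)
  have hv : ∀ k < r + s, N.arcW (v k) (v (k + 1)) ≠ ⊥ := by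
    intro k hk
    rcases lt_trichotomy k r with hkr | rfl | hkr
    · simp only [v, if_pos hkr.le, if_pos (Nat.succ_le_of_lt hkr)]
      exact hf k hkr
    · simp only [v, le_refl, if_true, if_neg (Nat.not_succ_le_self k)]
      rw [show f k = g 0 by rw [f1, g0]; simp, show k + 1 - k = 0 + 1 by omega]
      exact hg 0 (by omega)
    · simp only [v, if_neg (show ¬ k ≤ r by omega), if_neg (show ¬ k + 1 ≤ r by omega)]
      rw [show k + 1 - r = k - r + 1 by omega]
      exact hg _ (by omega)
  have hend : v (r + s) = (i, 0) := by
    rcases Nat.eq_zero_or_pos s with rfl | hs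
    · simp only [v, add_zero, le_refl, if_true, f1]
      obtain ⟨rfl, hd, -⟩ := h'.eq_of_zero
      simp; omega
    · simp only [v, if_neg (show ¬ r + s ≤ r by omega), Nat.add_sub_cancel_left, g1]
      simp
  refine ne_of_gt (lt_of_lt_of_le (EReal.bot_lt_coe _) (le_sSup ⟨r + s, h1, hn,
    ⟨fun k => v k, fun k => by simpa using hv k k.2⟩, ⟨i, ?_, ?_⟩, ⟨0, ?_⟩,
    ⟨⟨r, by omega⟩, ?_⟩, rfl⟩))
  · simp [v, f0]
  · simpa using hend
  · simp [v, f0]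
  · simp [v, f1]

end PTEG

/-! ## Witnesses bound the first token death -/

namespace PTEG

variable {n : ℕ} {N : PTEG n}

theorem ConsistentUpTo.arc_le {K : ℕ} {x : ℕ → Fin n → ℝ} (hx : N.ConsistentUpTo K x)
    {i j : Fin n} {d : ℤ} (ha : N.arcW (i, 0) (j, d) ≠ ⊥) {z : ℤ} (h0 : 0 ≤ z) (hK : z ≤ K)
    (h0' : 0 ≤ z + d) (hK' : z + d ≤ K) :
    (N.arcW (i, 0) (j, d)).toReal + x z.toNat i ≤ x (z + d).toNat j := by
  rw [consistentUpTo_iff, isPotential_M_iff] at hx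
  obtain ⟨hC, hP, hI⟩ := hx
  rw [← EReal.coe_le_coe_iff, EReal.coe_add, EReal.coe_toReal (N.arcW_ne_top _ _) ha]
  obtain ⟨m, rfl⟩ := Int.eq_ofNat_of_zero_le h0
  have hd := abs_le.1 (N.abs_le_one_of_arcW ha)
  obtain rfl | rfl | rfl : d = -1 ∨ d = 0 ∨ d = 1 := by omega
  · obtain ⟨m, rfl⟩ : ∃ l, m = l + 1 := ⟨m - 1, by omega⟩
    simpa [arcW] using hP m (by omega) j i
  · simpa [arcW] using hC m (by omega) j i
  · simpa [arcW, show ((m : ℤ) + 1).toNat = m + 1 by omega] using hI m (by omega) j i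

/-- A walk that stays in the columns `0, …, K` bounds differences of firing times. -/
theorem ConsistentUpTo.reach_le {K : ℕ} {x : ℕ → Fin n → ℝ} (hx : N.ConsistentUpTo K x)
    {r : ℕ} {i j : Fin n} {t : ℤ} {w : ℝ} (h : N.Reach r i j t w) {z : ℤ}
    (h0 : 0 ≤ 2 * z + t - r) (hK : 2 * z + t + r ≤ 2 * K) :
    w + x z.toNat i ≤ x (z + t).toNat j := by
  -- A walk with `r` arcs from column `z` to `z + t` stays between `(2z + t - r) / 2` and `(2z + t +
  -- r) / 2`, because every excursion must be undone.
  induction h generalizing z with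
  | nil i => simp
  | @cons r i k j d t w ha h ih =>
    have hd := abs_le.1 (N.abs_le_one_of_arcW ha)
    have ht := abs_le.1 h.abs_le
    push_cast at h0 hK
    have h1 := hx.arc_le ha (z := z) (by omega) (by omega) (by omega) (by omega)
    have h2 := ih (z := z + d) (by omega) (by omega)
    rw [add_assoc] at h2
    linarith

/-- The base columns `z + m * t` of the turns lie between `z` and `z + y * t`, so only the two ends
need room. -/
theorem ConsistentUpTo.reach_iterate_le {K : ℕ} {x : ℕ → Fin n → ℝ} (hx : N.ConsistentUpTo K x)
    {r : ℕ} {i : Fin n} {t : ℤ} {w : ℝ} (h : N.Reach r i i t w) {y : ℕ} {z : ℤ}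
    (h0 : r ≤ 2 * z) (h0' : r ≤ 2 * (z + y * t)) (hK : 2 * z + r ≤ 2 * K)
    (hK' : 2 * (z + y * t) + r ≤ 2 * K) :
    y * w + x z.toNat i ≤ x (z + y * t).toNat i := by
  have key : ∀ m ≤ y, (m : ℝ) * w + x z.toNat i ≤ x (z + m * t).toNat i := by
    intro m
    induction m with
    | zero => simp
    | succ m ih =>
      intro hm
      have h1 := ih (by omega)
      obtain ⟨l, rfl⟩ := Nat.exists_eq_add_of_le hm
      push_cast at h0' hK'
      have b : r ≤ 2 * (z + m * t) + t ∧ 2 * (z + m * t) + t + r ≤ 2 * K := by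
        rcases le_total 0 t with ht | ht
        · have hm0 : 0 ≤ (m : ℤ) * t := by positivity
          have hl0 : 0 ≤ (l : ℤ) * t := by positivity
          constructor <;> nlinarith
        · have hm0 : (m : ℤ) * t ≤ 0 := mul_nonpos_of_nonneg_of_nonpos (by positivity) ht
          have hl0 : (l : ℤ) * t ≤ 0 := mul_nonpos_of_nonneg_of_nonpos (by positivity) ht
          constructor <;> nlinarith
      have h2 := hx.reach_le h (z := z + m * t) (by omega) (by omega)
      have e : z + ((m + 1 : ℕ) : ℤ) * t = z + m * t + t := by push_cast; ring
      rw [e]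
      push_cast
      linarith
  exact key y le_rfl

/-- The circuit is `y` turns at `i`, a walk to `j`, `y'` turns at `j` and the walk back. Along it a
trajectory would give a positive total `≤ 0`. -/
theorem not_consistentUpTo_horizon {i j : Fin n} {t t' : ℤ} {w w' : ℝ} {y y' : ℕ}
    (hi : (t, w) ∈ N.S i) (hj : (t', w') ∈ N.S j) (h : N.IsSol i j t w t' w' (y, y'))
    (x : ℕ → Fin n → ℝ) : ¬ N.ConsistentUpTo (horizon n t y) x := by
  intro hx
  obtain ⟨hsum, hpos⟩ := h
  simp only at hsum hpos
  have hR : N.R i j ≠ ⊥ := by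
    intro hR
    simp [hR] at hpos
  obtain ⟨r, s, d, a, b, hrs, h1, h2, hR'⟩ := exists_reach_of_R hR
  obtain ⟨p, -, hp, h3⟩ := exists_reach_of_mem_S hi
  obtain ⟨q, -, hq, h4⟩ := exists_reach_of_mem_S hj
  rw [hR'] at hpos
  norm_cast at hpos
  have hn : 1 ≤ n := i.pos
  have hd1 := abs_le.1 h1.abs_le
  have hd2 := abs_le.1 h2.abs_le
  set u : ℤ := y * t with hu
  have hu' : (y' : ℤ) * t' = -u := by omega
  have habs : ((y * t.natAbs : ℕ) : ℤ) = |u| := by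
    rw [hu, abs_mul, Nat.cast_mul, Nat.abs_cast, Int.natCast_natAbs]
  set H := horizon n t y with hH
  have hHval : (H : ℤ) = |u| + 2 * n + 2 * ((n ^ 2 / 2 : ℕ) : ℤ) + 1 := by
    rw [hH, horizon]; push_cast [← habs]; ring
  set e : ℕ := n ^ 2 with he
  have hu1 := le_abs_self u
  have hu2 := neg_abs_le u
  have hu0 := abs_nonneg u
  -- The smaller of the columns `z`, `z + u` is `n + ⌊n² / 2⌋`. The second term covers the advance
  -- `d`, as `|d| ≤ r, s` and `r + s ≤ n²`; together with `n` it leaves room for the excursions.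
  obtain ⟨z, hz, hz'⟩ : ∃ z : ℤ, (z = n + ((e / 2 : ℕ) : ℤ) ∧ 0 ≤ u ∧ |u| = u ∨
      z = n + ((e / 2 : ℕ) : ℤ) - u ∧ u ≤ 0 ∧ |u| = -u) ∧ 0 ≤ z := by
    rcases le_total 0 u with h | h
    · exact ⟨_, Or.inl ⟨rfl, h, abs_of_nonneg h⟩, by omega⟩
    · exact ⟨_, Or.inr ⟨rfl, h, abs_of_nonpos h⟩, by omega⟩
  have g1 := hx.reach_iterate_le h3 (y := y) (z := z) (by omega) (by omega) (by omega) (by omega)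
  rw [← hu] at g1
  have g2 := hx.reach_le h1 (z := z + u) (by omega) (by omega)
  have g3 := hx.reach_iterate_le h4 (y := y') (z := z + u + d)
    (by omega) (by omega) (by omega) (by omega)
  rw [hu'] at g3
  have g4 := hx.reach_le h2 (z := z + u + d + -u) (by omega) (by omega)
  rw [show z + u + d + -u + -d = z by ring] at g4
  linarith

/-- A large multiple of the given solution outweighs the real number `R i j`; minimal solutions
exist because `ℕ × ℕ` is well-founded. -/
theorem exists_minimal_isSol {i j : Fin n} {t t' : ℤ} {w w' : ℝ}
    (h : N.IsWitness i j t w t' w') : ∃ q : ℕ × ℕ, Minimal (N.IsSol i j t w t' w') q := by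
  obtain ⟨hR, -, -, y, y', h1, h2⟩ := h
  obtain ⟨r, s, d, a, b, -, -, -, hR'⟩ := exists_reach_of_R hR
  obtain ⟨m, hm⟩ := exists_lt_nsmul h2 (-(a + b))
  refine exists_minimal_of_wellFoundedLT _ ⟨(m * y, m * y'), ?_, ?_⟩
  · push_cast
    linear_combination (m : ℤ) * h1
  · rw [hR']
    norm_cast
    rw [nsmul_eq_mul] at hm
    push_cast
    linarith

end PTEG

/-! ## Existence of witnesses -/

/-- A finite set of vectors in the plane whose cone contains no point on the positive vertical axis
lies below a line through the origin. -/
theorem exists_slope {C : Set (ℤ × ℝ)} (hfin : C.Finite) (hpos : ∃ p ∈ C, 0 < p.1)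
    (h0 : ∀ p ∈ C, p.1 = 0 → p.2 ≤ 0)
    (hpair : ∀ p ∈ C, ∀ q ∈ C, 0 < p.1 → q.1 < 0 → -q.1 * p.2 + p.1 * q.2 ≤ 0) :
    ∃ a : ℝ, ∀ p ∈ C, p.2 ≤ a * p.1 := by
  set L : Set ℝ := (fun p : ℤ × ℝ => p.2 / p.1) '' {p ∈ C | 0 < p.1}
  set U : Set ℝ := (fun p : ℤ × ℝ => p.2 / p.1) '' {p ∈ C | p.1 < 0}
  obtain ⟨b, hb⟩ : BddAbove L := ((hfin.subset fun _ h => h.1).image _).bddAbove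
  obtain ⟨p₀, hp₀, hp₀'⟩ := hpos
  -- The slope must separate the ratios of forward vectors from those of backward ones. Inserting
  -- `b` covers the case without backward vectors.
  obtain ⟨a, ha1, ha2⟩ : (upperBounds L ∩ lowerBounds (insert b U)).Nonempty := by
    refine exists_between_of_forall_le ⟨_, p₀, ⟨hp₀, hp₀'⟩, rfl⟩ ⟨b, Set.mem_insert _ _⟩ ?_
    rintro _ ⟨p, ⟨hp, hp'⟩, rfl⟩ _ (rfl | ⟨q, ⟨hq, hq'⟩, rfl⟩)
    · exact hb ⟨p, ⟨hp, hp'⟩, rfl⟩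
    · have h := hpair p hp q hq hp' hq'
      have hp1 : (0 : ℝ) < p.1 := by exact_mod_cast hp'
      have hq1 : (q.1 : ℝ) < 0 := by exact_mod_cast hq'
      simp only
      rw [div_le_iff₀ hp1, div_mul_eq_mul_div, le_div_iff_of_neg hq1]
      linarith
  refine ⟨a, fun p hp => ?_⟩
  rcases lt_trichotomy p.1 0 with h | h | h
  · have := ha2 (Set.mem_insert_of_mem _ ⟨p, ⟨hp, h⟩, rfl⟩)
    rwa [le_div_iff_of_neg (by exact_mod_cast h)] at this
  · rw [h]; simpa using h0 p hp h
  · have := ha1 ⟨p, ⟨hp, h⟩, rfl⟩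
    rwa [div_le_iff₀ (by exact_mod_cast h)] at this

/-- Here `s` is the backward advance of a cycle of length `l`, `k` the number of turns, namely `d /
s` rounded up, and `k * s - d` the number of compensating self-loops. After clearing `s`, the bound
reduces to the square of `s * n - (l + s)`. -/
theorem turns_bound {n l s m e d Q k : ℤ} (hs : 1 ≤ s) (hsl : s ≤ l) (hk : k * s ≤ d + s - 1)
    (he : 2 * e ≤ l - s) (hme : m + e ≤ l - s) (hd : d ≤ Q + e) (hQ : Q ≤ 2 * n - 2 * l) :
    Q + m + k * l + (k * s - d) ≤ n ^ 2 := by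
  set T := Q + m + k * l + (k * s - d) with hT
  have h1 : s * T ≤ s * (Q + m) + d * l + (s - 1) * (l + s) := by
    have : s * T = s * (Q + m - d) + (k * s) * (l + s) := by rw [hT]; ring
    rw [this]
    have := mul_le_mul_of_nonneg_right hk (show 0 ≤ l + s by omega)
    linarith
  have h2 : d * l ≤ (Q + e) * l := mul_le_mul_of_nonneg_right hd (by omega)
  have h3 : s * (m + e) ≤ s * (l - s) := mul_le_mul_of_nonneg_left hme (by omega)
  have h4 : 2 * e * (l - s) ≤ (l - s) * (l - s) := mul_le_mul_of_nonneg_right he (by omega)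
  have h5 : 2 * (s * T) ≤ (l + s) * (2 * Q + l + s - 2) := by linarith
  have h6 : (l + s) * (2 * Q + l + s - 2) ≤ (l + s) * (4 * n - 3 * l + s - 2) :=
    mul_le_mul_of_nonneg_left (by omega) (by omega)
  have h7 : 0 ≤ (l + s) * (s * (3 * l - s + 2) - 2 * (l + s)) := by
    refine mul_nonneg (by omega) ?_
    nlinarith [mul_nonneg (show 0 ≤ s by omega) (show 0 ≤ l - s by omega),
      mul_nonneg (show 0 ≤ s - 1 by omega) (show 0 ≤ l by omega)]
  have h8 : s * (2 * (s * T)) ≤ s * ((l + s) * (4 * n - 3 * l + s - 2)) :=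
    mul_le_mul_of_nonneg_left (h5.trans h6) (by omega)
  have h9 : 2 * s ^ 2 * T ≤ 2 * s ^ 2 * n ^ 2 := by
    nlinarith [sq_nonneg (s * n - (l + s))]
  exact le_of_mul_le_mul_left h9 (by positivity)

/-- Numbers of turns that balance a circuit with at most `n ^ 2` arcs. -/
theorem exists_turns {n l p q m : ℕ} {D E e t : ℤ} (hD : |D| ≤ p) (hE : |E| ≤ q) (he : |e| ≤ m)
    (he' : |t - e| ≤ ((l - m : ℕ) : ℤ)) (ht : t < 0) (hm : m < l) (hp : p + l ≤ n)
    (hq : q + l ≤ n) :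
    ∃ k c : ℕ, D + e + E + k * t + c = 0 ∧ p + m + q + k * l + c ≤ n ^ 2 := by
  have hD := abs_le.1 hD
  have hE := abs_le.1 hE
  have he := abs_le.1 he
  have he' := abs_le.1 he'
  rcases le_or_gt (D + e + E) 0 with hd | hd
  -- No turns are needed: self-loops make up for the negative advance. The length is at most `4n - 4
  -- ≤ n²`.
  · refine ⟨0, (-(D + e + E)).toNat, by push_cast; omega, ?_⟩
    have h1 : p + m + q + 0 * l + (-(D + e + E)).toNat + 4 ≤ 4 * n := by omega
    have h2 : 4 * n ≤ n ^ 2 + 4 := by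
      zify
      nlinarith [sq_nonneg ((n : ℤ) - 2)]
    omega
  · obtain ⟨s, rfl⟩ : ∃ s : ℤ, t = -s := ⟨-t, by ring⟩
    set d := D + e + E with hd'
    have hs : 1 ≤ s := by omega
    have hsl : s ≤ l := by omega
    set k : ℤ := (d + s - 1) / s
    have hk0 : 0 ≤ k := Int.ediv_nonneg (by omega) (by omega)
    have hk1 : k * s ≤ d + s - 1 := Int.ediv_mul_le _ (by omega)
    have hk2 : d ≤ k * s := by
      have := Int.lt_ediv_add_one_mul_self (d + s - 1) (show 0 < s by omega)
      linarith
    have hkz : ((k.toNat : ℕ) : ℤ) = k := Int.toNat_of_nonneg hk0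
    refine ⟨k.toNat, (k * s - d).toNat, ?_, ?_⟩
    · rw [hkz, Int.toNat_of_nonneg (by omega)]
      ring
    · zify
      rw [hkz, Int.toNat_of_nonneg (by omega)]
      have e1 : 2 * e ≤ l - s := by omega
      have e2 : m + e ≤ l - s := by omega
      have e3 : d ≤ p + q + e := by omega
      have e4 : (p : ℤ) + q ≤ 2 * n - 2 * l := by omega
      have := turns_bound hs hsl hk1 e1 e2 e3 e4
      linarith

/-! ### Simple cycles, strong components and short common circuits -/

namespace PTEG

variable {n : ℕ} {N : PTEG n}

/-- The entry `(a, b)` is the weight of an actual walk from `b` to `a`, since the finite suprema are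
attained. -/
theorem reach_of_mpPow {K r : ℕ} {a b : Fin (K + 1) × Fin n} (h : mpPow (N.M K) r a b ≠ ⊥) :
    ∃ w : ℝ, mpPow (N.M K) r a b = w ∧ N.Reach r b.2 a.2 ((a.1 : ℤ) - b.1) w := by
  induction r generalizing b with
  | zero =>
    by_cases hab : a = b
    · subst hab
      exact ⟨0, by simp [mpPow, mpOne], (Reach.nil a.2).of_eq rfl (by simp) rfl⟩
    · simp [mpPow, mpOne, hab] at h
  | succ r ih =>
    have : Nonempty (Fin (K + 1) × Fin n) := ⟨a⟩
    obtain ⟨m, hm⟩ := exists_eq_ciSup_of_finite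
      (f := fun m => mpPow (N.M K) r a m + N.M K m b)
    have h1 : mpPow (N.M K) (r + 1) a b = mpPow (N.M K) r a m + N.M K m b := hm.symm
    rw [h1] at h ⊢
    rw [Ne, EReal.add_eq_bot_iff, not_or] at h
    obtain ⟨w, hw, hr⟩ := ih h.1
    have harc : N.arcW (b.2, 0) (m.2, (m.1 : ℤ) - b.1) = N.M K m b := by
      unfold arcW M
      simp only [Fin.ext_iff]
      split_ifs <;> first | rfl | omega
    refine ⟨(N.M K m b).toReal + w, ?_, ?_⟩
    · rw [EReal.coe_add, EReal.coe_toReal (N.M_ne_top K m b) h.2, hw, add_comm]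
    · rw [← harc]
      exact (Reach.cons (by rw [harc]; exact h.2) hr).of_eq rfl (by ring) rfl

theorem exists_pos_circuit {K : ℕ} (h : ¬ InGamma (N.M K)) :
    ∃ (r : ℕ) (i : Fin n) (w : ℝ), 0 < w ∧ N.Reach r i i 0 w := by
  unfold InGamma at h
  push Not at h
  obtain ⟨r, -, a, ha⟩ := h
  obtain ⟨w, hw, hr⟩ := reach_of_mpPow (ne_bot_of_gt ha)
  rw [hw] at ha
  exact ⟨r, a.2, w, by exact_mod_cast ha, hr.of_eq rfl (by ring) rfl⟩

/-- The node sequence `v` is, up to translation, a circuit of length `l` that visits every row at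
most once. -/
def SimpleCycle (N : PTEG n) (l : ℕ) (v : ℕ → Fin n × ℤ) : Prop :=
  1 ≤ l ∧ (∀ k < l, N.arcW (v k) (v (k + 1)) ≠ ⊥) ∧ (v l).1 = (v 0).1 ∧
    Set.InjOn (fun k => (v k).1) (Set.Iio l)

/-- The weight of the first `l` arcs. -/
noncomputable def seqWeight (N : PTEG n) (l : ℕ) (v : ℕ → Fin n × ℤ) : ℝ :=
  ∑ k ∈ Finset.Ico 0 l, (N.arcW (v k) (v (k + 1))).toReal

/-- The rows `i` and `j` lie in the same strongly connected component. -/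
def Conn (N : PTEG n) (i j : Fin n) : Prop :=
  (∃ r t w, N.Reach r i j t w) ∧ ∃ r t w, N.Reach r j i t w

theorem SimpleCycle.length_le {l : ℕ} {v : ℕ → Fin n × ℤ} (h : N.SimpleCycle l v) : l ≤ n := by
  have h1 : ((Finset.range l).image fun k => (v k).1).card = l := by
    rw [Finset.card_image_of_injOn (by simpa using h.2.2.2), Finset.card_range]
  rw [← h1]
  simpa using Finset.card_le_univ ((Finset.range l).image fun k => (v k).1)

/-- Two nodes cut a simple cycle into two walks. -/
theorem SimpleCycle.cut {l : ℕ} {v : ℕ → Fin n × ℤ} (h : N.SimpleCycle l v) {a b : ℕ}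
    (ha : a < l) (hb : b < l) : ∃ m < l, ∃ e x y, N.Reach m (v a).1 (v b).1 e x ∧
      N.Reach (l - m) (v b).1 (v a).1 ((v l).2 - (v 0).2 - e) y ∧ x + y = N.seqWeight l v := by
  have hseg : ∀ p q : ℕ, p ≤ q → q ≤ l → N.Reach (q - p) (v p).1 (v q).1
      ((v q).2 - (v p).2) (∑ k ∈ Finset.Ico p q, (N.arcW (v k) (v (k + 1))).toReal) := by
    intro p q hpq hqr
    have := reach_of_nodes (N := N) v p (q - p) fun k _ hk => h.2.1 k (by omega)
    rwa [Nat.add_sub_cancel' hpq] at this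
  have hsum : ∀ p q : ℕ, p ≤ q → q ≤ l → N.seqWeight l v =
      ∑ k ∈ Finset.Ico p q, (N.arcW (v k) (v (k + 1))).toReal +
      (∑ k ∈ Finset.Ico q l, (N.arcW (v k) (v (k + 1))).toReal +
      ∑ k ∈ Finset.Ico 0 p, (N.arcW (v k) (v (k + 1))).toReal) := by
    intro p q hpq hqr
    rw [seqWeight, ← Finset.sum_Ico_consecutive _ (Nat.zero_le p) (hpq.trans hqr),
      ← Finset.sum_Ico_consecutive _ hpq hqr]
    ring
  have hout : ∀ p q : ℕ, p ≤ q → q ≤ l → N.Reach (l - q + p) (v q).1 (v p).1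
      ((v l).2 - (v 0).2 - ((v q).2 - (v p).2))
      (∑ k ∈ Finset.Ico q l, (N.arcW (v k) (v (k + 1))).toReal +
      ∑ k ∈ Finset.Ico 0 p, (N.arcW (v k) (v (k + 1))).toReal) := by
    intro p q hpq hqr
    have g1 := hseg q l hqr le_rfl
    have g2 := hseg 0 p (Nat.zero_le p) (hpq.trans hqr)
    rw [h.2.2.1] at g1
    exact (g1.append g2).of_eq (by omega) (by ring) rfl
  rcases le_or_gt a b with hab | hab
  · refine ⟨b - a, by omega, _, _, _, hseg a b hab hb.le,
      (hout a b hab hb.le).of_eq (by omega) rfl rfl, (hsum a b hab hb.le).symm⟩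
  · refine ⟨l - a + b, by omega, _, _, _, hout b a hab.le ha.le,
      (hseg b a hab.le ha.le).of_eq (by omega) (by ring) rfl, ?_⟩
    rw [hsum b a hab.le ha.le, add_comm]

theorem SimpleCycle.reach {l : ℕ} {v : ℕ → Fin n × ℤ} (h : N.SimpleCycle l v) {a : ℕ}
    (ha : a < l) : N.Reach l (v a).1 (v a).1 ((v l).2 - (v 0).2) (N.seqWeight l v) := by
  obtain ⟨m, hm, e, x, y, h1, h2, h3⟩ := h.cut ha ha
  exact (h1.append h2).of_eq (by omega) (by ring) h3

/-- Every closed walk contains a simple cycle, whose removal leaves a closed walk. -/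
theorem Reach.exists_simpleCycle {r : ℕ} {i : Fin n} {t : ℤ} {w : ℝ} (h : N.Reach r i i t w)
    (hr : 1 ≤ r) : ∃ l v, l ≤ r ∧ N.SimpleCycle l v ∧ N.Conn i (v 0).1 ∧
      N.Reach (r - l) i i (t - ((v l).2 - (v 0).2)) (w - N.seqWeight l v) := by
  obtain ⟨f, f0, fr, hf, hw⟩ := h.exists_nodes 0
  -- The least gap between two visits to the same row gives a simple cycle; translation closes the
  -- walk again after its removal.
  have hex : ∃ g, 1 ≤ g ∧ ∃ a, a + g ≤ r ∧ (f (a + g)).1 = (f a).1 :=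
    ⟨r, hr, 0, by omega, by simp [f0, fr]⟩
  classical
  set g := Nat.find hex with hg
  obtain ⟨hg1, a, har, hag⟩ := Nat.find_spec hex
  rw [← hg] at hg1 har hag
  have hmin : ∀ b c, b < c → c ≤ r → (f c).1 = (f b).1 → g ≤ c - b := by
    intro b c hbc hcr hfe
    refine Nat.find_min' hex ⟨by omega, b, by omega, ?_⟩
    rwa [Nat.add_sub_cancel' hbc.le]
  have s1 := reach_of_nodes (N := N) f 0 a fun k _ hk => hf k (by omega)
  have s3 := reach_of_nodes (N := N) f (a + g) (r - (a + g)) fun k _ hk => hf k (by omega)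
  have hwt : N.seqWeight g (fun k => f (a + k)) =
      ∑ k ∈ Finset.Ico a (a + g), (N.arcW (f k) (f (k + 1))).toReal := by
    have := Finset.sum_Ico_add (fun k => (N.arcW (f k) (f (k + 1))).toReal) 0 g a
    simp only [add_assoc, zero_add] at this
    rw [seqWeight, add_comm a g]
    exact this
  rw [Nat.add_sub_cancel' har, hag] at s3
  rw [zero_add] at s1
  rw [f0] at s1
  rw [fr] at s3
  refine ⟨g, fun k => f (a + k), by omega, ⟨hg1, fun k hk => hf _ (by omega), hag, ?_⟩,
    ⟨⟨_, _, _, s1⟩, ⟨_, _, _, s3⟩⟩, ?_⟩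
  · intro b hb c hc hbc
    simp only [Set.mem_Iio] at hb hc hbc
    rcases lt_trichotomy b c with h | h | h
    · have := hmin (a + b) (a + c) (by omega) (by omega) hbc.symm
      omega
    · exact h
    · have := hmin (a + c) (a + b) (by omega) (by omega) hbc
      omega
  · refine (s1.append s3).of_eq (by omega) (by simp only [add_zero]; ring) ?_
    rw [hwt, ← hw, Finset.range_eq_Ico, ← Finset.sum_Ico_consecutive _ (Nat.zero_le a)
      (show a ≤ r by omega), ← Finset.sum_Ico_consecutive _ (show a ≤ a + g by omega) har]
    ring

theorem Conn.trans {i j k : Fin n} (h : N.Conn i j) (h' : N.Conn j k) : N.Conn i k := by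
  obtain ⟨⟨r, t, w, h1⟩, ⟨r', t', w', h2⟩⟩ := h
  obtain ⟨⟨s, u, v, h3⟩, ⟨s', u', v', h4⟩⟩ := h'
  exact ⟨⟨_, _, _, h1.append h3⟩, ⟨_, _, _, h4.append h2⟩⟩

theorem Conn.symm {i j : Fin n} (h : N.Conn i j) : N.Conn j i := ⟨h.2, h.1⟩

/-- A linear bound on simple cycles holds for all closed walks. -/
theorem Reach.le_slope {i : Fin n} {a : ℝ}
    (ha : ∀ l v, N.SimpleCycle l v → N.Conn i (v 0).1 →
      N.seqWeight l v ≤ a * (((v l).2 - (v 0).2 : ℤ) : ℝ))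
    {r : ℕ} {t : ℤ} {w : ℝ} (h : N.Reach r i i t w) : w ≤ a * t := by
  induction r using Nat.strong_induction_on generalizing t w with
  | _ r ih =>
    rcases Nat.eq_zero_or_pos r with rfl | hr
    · obtain ⟨-, rfl, rfl⟩ := h.eq_of_zero
      simp
    · obtain ⟨l, v, hl, hc, hi, hrest⟩ := h.exists_simpleCycle hr
      have h1 := ih _ (by have := hc.1; omega) hrest
      have h2 := ha l v hc hi
      push_cast at h1 h2
      linarith

/-- The identity in `matI` provides this arc. Such loops compensate any negative advance, one column
per arc. -/
theorem exists_selfLoop (N : PTEG n) (i : Fin n) : ∃ w, N.Reach 1 i i 1 w := by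
  refine ⟨_, Reach.single (d := 1) ?_⟩
  have : N.arcW (i, 0) (i, 1) = N.matI i i := by simp [arcW]
  rw [this]
  exact (lt_of_lt_of_le (by simp [mpOne]) (le_max_right _ (mpOne i i))).ne'

/-- A shortest walk between two disjoint sets of rows. -/
theorem exists_short_reach {X Y : Finset (Fin n)} (hXY : Disjoint X Y)
    (h : ∃ r, ∃ x ∈ X, ∃ y ∈ Y, ∃ t w, N.Reach r x y t w) :
    ∃ p, ∃ x ∈ X, ∃ y ∈ Y, ∃ t w, N.Reach p x y t w ∧ p + X.card + Y.card ≤ n + 1 := by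
  classical
  set p := Nat.find h with hp
  obtain ⟨x, hx, y, hy, t, w, hr⟩ := Nat.find_spec h
  rw [← hp] at hr
  have hmin : ∀ m, ∀ x ∈ X, ∀ y ∈ Y, ∀ t w, N.Reach m x y t w → p ≤ m :=
    fun m x hx y hy t w hr => Nat.find_min' h ⟨x, hx, y, hy, t, w, hr⟩
  refine ⟨p, x, hx, y, hy, t, w, hr, ?_⟩
  obtain ⟨v, v0, vp, hv, -⟩ := hr.exists_nodes 0
  have hseg : ∀ a b : ℕ, a ≤ b → b ≤ p → ∃ t w, N.Reach (b - a) (v a).1 (v b).1 t w := by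
    intro a b hab hbp
    have := reach_of_nodes (N := N) v a (b - a) fun k _ hk => hv k (by omega)
    rw [Nat.add_sub_cancel' hab] at this
    exact ⟨_, _, this⟩
  have hx0 : (v 0).1 ∈ X := by rw [v0]; exact hx
  have hyp : (v p).1 ∈ Y := by rw [vp]; exact hy
  -- A repeated row, or an interior row in `X` or `Y`, would give a shorter walk. Hence the `p - 1`
  -- interior rows are distinct and avoid `X ∪ Y`.
  have hinj : ∀ a b, a < b → b ≤ p → (v a).1 ≠ (v b).1 := by
    intro a b hab hb heq
    obtain ⟨t1, w1, h1⟩ := hseg 0 a (by omega) (by omega)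
    obtain ⟨t2, w2, h2⟩ := hseg b p (by omega) le_rfl
    rw [heq] at h1
    have := hmin _ _ hx0 _ hyp _ _ (h1.append h2)
    omega
  have hX : ∀ a, 0 < a → a ≤ p → (v a).1 ∉ X := by
    intro a ha hap hmem
    obtain ⟨t2, w2, h2⟩ := hseg a p hap le_rfl
    have := hmin _ _ hmem _ hyp _ _ h2
    omega
  have hY : ∀ a < p, (v a).1 ∉ Y := by
    intro a ha hmem
    obtain ⟨t2, w2, h2⟩ := hseg 0 a (by omega) ha.le
    have := hmin _ _ hx0 _ hmem _ _ h2
    omega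
  set Z := (Finset.Ioo 0 p).image fun k => (v k).1 with hZ
  have hZc : Z.card = p - 1 := by
    rw [hZ, Finset.card_image_of_injOn, Nat.card_Ioo, Nat.sub_zero]
    intro a ha b hb hab
    simp only [Finset.coe_Ioo, Set.mem_Ioo] at ha hb hab
    rcases lt_trichotomy a b with h | h | h
    · exact absurd hab (hinj a b h (by omega))
    · exact h
    · exact absurd hab.symm (hinj b a h (by omega))
  have hZX : Disjoint (X ∪ Y) Z := by
    rw [Finset.disjoint_right]
    intro z hz
    obtain ⟨k, hk, rfl⟩ := Finset.mem_image.1 hz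
    rw [Finset.mem_Ioo] at hk
    rw [Finset.mem_union, not_or]
    exact ⟨hX k hk.1 (by omega), hY k hk.2⟩
  have hcard := Finset.card_le_univ (X ∪ Y ∪ Z)
  rw [Finset.card_union_of_disjoint hZX, Finset.card_union_of_disjoint hXY, hZc,
    Fintype.card_fin] at hcard
  omega

/-- Every row in the component of a simple cycle with negative advance lies on a circuit with at
most `n ^ 2` arcs that meets the cycle. -/
theorem SimpleCycle.exists_R_ne_bot {l : ℕ} {v : ℕ → Fin n × ℤ} (h : N.SimpleCycle l v)
    {i : Fin n} (hi : N.Conn i (v 0).1) (ht : (v l).2 - (v 0).2 < 0) (hn : 2 ≤ n) :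
    ∃ k < l, N.R i (v k).1 ≠ ⊥ := by
  obtain ⟨c, hc⟩ := N.exists_selfLoop i
  have hln := h.length_le
  have hl := h.1
  by_cases hmem : ∃ k < l, (v k).1 = i
  · obtain ⟨k, hk, rfl⟩ := hmem
    refine ⟨k, hk, ?_⟩
    -- For a row on the cycle, one turn and at most `l` self-loops suffice: at most `2n ≤ n²` arcs.
    have h1 := h.reach hk
    have h2 := abs_le.1 h1.abs_le
    have h3 := hc.iterate (-((v l).2 - (v 0).2)).toNat
    refine R_ne_bot h1 (h3.of_eq rfl ?_ rfl) (by omega) ?_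
    · rw [Int.toNat_of_nonneg (by omega)]; ring
    · have : 2 * n ≤ n ^ 2 := by nlinarith
      omega
  · push Not at hmem
    classical
    set X := (Finset.range l).image fun k => (v k).1 with hX
    have hXc : X.card = l := by
      rw [hX, Finset.card_image_of_injOn (by simpa using h.2.2.2), Finset.card_range]
    have hdis : Disjoint {i} X := by
      rw [Finset.disjoint_singleton_left, hX, Finset.mem_image]
      rintro ⟨k, hk, hki⟩
      exact hmem k (Finset.mem_range.1 hk) hki
    have h0 : (v 0).1 ∈ X := Finset.mem_image_of_mem _ (Finset.mem_range.2 h.1)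
    obtain ⟨⟨r1, t1, w1, hr1⟩, ⟨r2, t2, w2, hr2⟩⟩ := hi
    obtain ⟨p, i', hi', x, hx, D, w, hp, hpn⟩ := exists_short_reach hdis
      ⟨r1, i, by simp, _, h0, t1, w1, hr1⟩
    obtain ⟨q, x', hx', i'', hi'', E, w', hq, hqn⟩ := exists_short_reach hdis.symm
      ⟨r2, _, h0, i, by simp, t2, w2, hr2⟩
    rw [Finset.mem_singleton] at hi' hi''
    subst hi' hi''
    obtain ⟨a, ha, rfl⟩ := Finset.mem_image.1 hx
    obtain ⟨b, hb, rfl⟩ := Finset.mem_image.1 hx'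
    rw [Finset.mem_range] at ha hb
    rw [Finset.card_singleton, hXc] at hpn hqn
    -- The circuit enters the cycle at `a`, makes `k` turns, follows the cycle to `b`, returns to
    -- the row and ends with `c'` self-loops.
    obtain ⟨m, hm, e, _, _, h1, h2, -⟩ := h.cut ha hb
    obtain ⟨k, c', hbal, hlen⟩ := exists_turns (n := n) hp.abs_le hq.abs_le h1.abs_le h2.abs_le ht hm
      (by omega) (by omega)
    refine ⟨a, ha, R_ne_bot hp ((((h.reach ha).iterate k).append
      (h1.append (hq.append (hc.iterate c')))).of_eq rfl ?_ rfl) ?_ ?_⟩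
    · linarith
    · by_contra h0
      have hp0 : p = 0 := by omega
      subst hp0
      exact hmem a ha hp.eq_of_zero.1.symm
    · linarith

/-- The forward loop has weight at most `N.B 1 i i`, because a window is nonempty and its upper end
nonnegative; the backward loop has weight `-N.B 1 i i`. -/
theorem Reach.loops_nonpos {i : Fin n} {w w' : ℝ} (h : N.Reach 1 i i 1 w)
    (h' : N.Reach 1 i i (-1) w') : w + w' ≤ 0 := by
  have e1 : ∀ {d : ℤ} {w : ℝ}, N.Reach 1 i i d w → N.arcW (i, 0) (i, d) = w := by
    intro d w h
    generalize hr : 1 = r at h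
    cases h with
    | nil => omega
    | cons ha h =>
      obtain rfl : _ = 0 := by simpa using hr.symm
      obtain ⟨rfl, rfl, rfl⟩ := h.eq_of_zero
      simp only [add_zero]
      exact (EReal.coe_toReal (N.arcW_ne_top _ _) ha).symm
  have h1 : N.matI i i = w := by simpa [arcW] using e1 h
  have h2 : N.matP i i = w' := by simpa [arcW] using e1 h'
  have hle : N.matI i i ≤ N.B 1 i i :=
    max_le (N.A_le_B 1 i i) (by simpa [mpOne] using N.B_nonneg 1 i i)
  have h3 : N.B 1 i i = ((-w' : ℝ) : EReal) := by
    rw [← neg_neg (N.B 1 i i), EReal.coe_neg, ← h2, matP]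
  rw [h1, h3] at hle
  have := EReal.coe_le_coe_iff.1 hle
  linarith

theorem exists_isWitness (h : ¬ N.WeaklyConsistent) :
    ∃ (i j : Fin n) (t : ℤ) (w : ℝ) (t' : ℤ) (w' : ℝ), N.IsWitness i j t w t' w' := by
  unfold WeaklyConsistent at h
  push Not at h
  obtain ⟨K, hK⟩ := h
  obtain ⟨r, i, w, hw, hr⟩ := exists_pos_circuit (N := N) (K := K)
    (by rw [inGamma_M_iff]; push Not; exact hK)
  by_contra! hno
  -- The component of the positive circuit is what counts: all its cycles must lie below a common
  -- line.
  set C : Set (ℤ × ℝ) := {p | ∃ l v, N.SimpleCycle l v ∧ N.Conn i (v 0).1 ∧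
    p = ((v l).2 - (v 0).2, N.seqWeight l v)} with hC
  have hfin : C.Finite := by
    refine ((finite_reach_le (N := N) n).image fun p => p.2.2).subset ?_
    rintro _ ⟨l, v, hc, -, rfl⟩
    exact ⟨((v 0).1, (v 0).1, _, _), ⟨l, hc.length_le, hc.reach hc.1⟩, rfl⟩
  have hpos : ∃ p ∈ C, 0 < p.1 := by
    obtain ⟨c, hc⟩ := N.exists_selfLoop i
    obtain ⟨l, v, hl, hcy, hcon, hrest⟩ := hc.exists_simpleCycle le_rfl
    obtain rfl : l = 1 := le_antisymm hl hcy.1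
    have := hrest.eq_of_zero.2.1
    exact ⟨_, ⟨1, v, hcy, hcon, rfl⟩, by simp only; omega⟩
  have h0 : ∀ p ∈ C, p.1 = 0 → p.2 ≤ 0 := by
    rintro _ ⟨l, v, hc, hcon, rfl⟩ h0
    simp only at h0 ⊢
    by_contra! hlt
    have hr := hc.reach hc.1
    obtain ⟨w', hw', hS⟩ := hr.exists_mem_S hc.1 hc.length_le
    rw [h0] at hS hr
    refine hno (v 0).1 (v 0).1 0 w' 0 w' ⟨?_, hS, hS, 1, 0, by simp, by simpa using hlt.trans_le hw'⟩
    have := hc.length_le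
    have := hc.1
    exact R_ne_bot hr ((Reach.nil _).of_eq rfl (by simp) rfl) (by omega) (by nlinarith)
  have hpair : ∀ p ∈ C, ∀ q ∈ C, 0 < p.1 → q.1 < 0 → -q.1 * p.2 + p.1 * q.2 ≤ 0 := by
    rintro _ ⟨l, v, hc, hcon, rfl⟩ _ ⟨l', v', hc', hcon', rfl⟩ hp hq
    simp only at hp hq ⊢
    by_contra! hlt
    have hr := hc.reach hc.1
    have hn : 1 ≤ n := i.pos
    have hl := hc.length_le
    have hl' := hc'.length_le
    -- For `n = 1` a circuit may have only one arc, so two opposite loops need not form one; their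
    -- total weight is nonpositive anyway.
    rcases Nat.lt_or_ge n 2 with hn2 | hn2
    · obtain rfl : n = 1 := by omega
      have hr' := hc'.reach hc'.1
      obtain rfl : l = 1 := le_antisymm hl hc.1
      obtain rfl : l' = 1 := le_antisymm hl' hc'.1
      have b1 := abs_le.1 hr.abs_le
      have b2 := abs_le.1 hr'.abs_le
      have e1 : (v 1).2 - (v 0).2 = 1 := by push_cast at b1; omega
      have e2 : (v' 1).2 - (v' 0).2 = -1 := by push_cast at b2; omega
      rw [e1] at hr
      rw [e2, Subsingleton.elim (v' 0).1 (v 0).1] at hr'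
      have := hr.loops_nonpos hr'
      rw [e1, e2] at hlt
      push_cast at hlt
      linarith
    · obtain ⟨k, hk, hR⟩ := hc'.exists_R_ne_bot (hcon.symm.trans hcon') hq hn2
      obtain ⟨w1, hw1, hS1⟩ := hr.exists_mem_S hc.1 hl
      obtain ⟨w2, hw2, hS2⟩ := (hc'.reach hk).exists_mem_S hc'.1 hl'
      set t := (v l).2 - (v 0).2
      set t' := (v' l').2 - (v' 0).2
      -- The multiplicities `-t'` and `t` cancel the advances, and passing to the maximal weights
      -- `w1`, `w2` only increases the sum.
      refine hno _ _ _ w1 _ w2 ⟨hR, hS1, hS2, (-t').toNat, t.toNat, ?_, ?_⟩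
      · rw [Int.toNat_of_nonneg (by omega), Int.toNat_of_nonneg (by omega)]; ring
      · have c1 : (((-t').toNat : ℕ) : ℝ) = -t' := by
          have : (((-t').toNat : ℕ) : ℤ) = -t' := Int.toNat_of_nonneg (by omega)
          exact_mod_cast this
        have c2 : ((t.toNat : ℕ) : ℝ) = t := by
          have : ((t.toNat : ℕ) : ℤ) = t := Int.toNat_of_nonneg (by omega)
          exact_mod_cast this
        rw [c1, c2]
        have p1 : (0 : ℝ) < t := by exact_mod_cast hp
        have p2 : (t' : ℝ) < 0 := by exact_mod_cast hq
        nlinarith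
  obtain ⟨a, ha⟩ := exists_slope hfin hpos h0 hpair
  have := hr.le_slope (a := a) fun l v hc hcon => ha _ ⟨l, v, hc, hcon, rfl⟩
  simp only [Int.cast_zero, mul_zero] at this
  linarith

end PTEG

/-! ## Reasoning about programs -/

/-- Started in `s`, the program `p` halts after at most `T` steps in a state that satisfies `Q`. -/
def Runs (p : Prog) (s : MState) (T : ℕ) (Q : MState → Prop) : Prop :=
  ∃ t ≤ T, ∃ s', Exec p s t s' ∧ Q s'

namespace Runs

variable {p q : Prog} {s : MState} {T T' : ℕ} {Q Q' : MState → Prop}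

theorem mono (h : Runs p s T Q) (hT : T ≤ T') (hQ : ∀ s, Q s → Q' s) : Runs p s T' Q' := by
  obtain ⟨t, ht, s', he, hs⟩ := h
  exact ⟨t, ht.trans hT, s', he, hQ s' hs⟩

theorem skip (h : Q s) : Runs .skip s (T + 1) Q := ⟨1, by omega, s, .skip s, h⟩

theorem op {o : Instr} (h : Q (o.run s)) : Runs (.op o) s (T + 1) Q :=
  ⟨1, by omega, _, .op o s, h⟩

theorem seq (h : Runs p s T fun s' => Runs q s' T' Q) : Runs (.seq p q) s (T + T') Q := by
  obtain ⟨t, ht, s', he, t', ht', s'', he', hs⟩ := h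
  exact ⟨t + t', by omega, s'', .seq he he', hs⟩

theorem seq_op {o : Instr} (h : Runs q (o.run s) T Q) : Runs (.seq (.op o) q) s (T + 1) Q := by
  rw [add_comm]
  exact seq (T := 1) (op (T := 0) h)

theorem ite {b : Cond} (h1 : b.holds s → Runs p s T Q) (h2 : ¬ b.holds s → Runs q s T Q) :
    Runs (.ite b p q) s (T + 1) Q := by
  by_cases hb : b.holds s
  · obtain ⟨t, ht, s', he, hs⟩ := h1 hb
    exact ⟨t + 1, by omega, s', .ite_true hb he, hs⟩
  · obtain ⟨t, ht, s', he, hs⟩ := h2 hb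
    exact ⟨t + 1, by omega, s', .ite_false hb he, hs⟩

end Runs

/-- `for x = 0, …, (content of lim) - 1 do body`; register `7` must contain `1`. -/
def forTo (x lim : ℕ) (body : Prog) : Prog :=
  .seq (.op (.const x 0)) (.loop (.regLt x lim) (.seq body (.op (.add x x 7))))

/-- Each round costs the body, the increment and the test; the last `2` is the initialisation and
the final failing test. -/
theorem Runs.forTo {x lim m T : ℕ} {body : Prog} {I : ℕ → MState → Prop} {s : MState}
    (h0 : I 0 (s.set x 0))
    (hI : ∀ k s, I k s → s.reg x = k ∧ s.reg lim = m)
    (hbody : ∀ k < m, ∀ s, I k s → Runs body s T fun s' =>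
      I (k + 1) (s'.set x (s'.reg x + s'.reg 7))) :
    Runs (forTo x lim body) s (m * (T + 2) + 2) (I m) := by
  have key : ∀ d k s, k + d = m → I k s →
      Runs (.loop (.regLt x lim) (.seq body (.op (.add x x 7)))) s (d * (T + 2) + 1) (I m) := by
    intro d
    induction d with
    | zero =>
      intro k s hk h
      obtain ⟨h1, h2⟩ := hI k s h
      obtain rfl : k = m := by omega
      refine ⟨1, by omega, s, .loop_false ?_, h⟩
      simp [Cond.holds, h1, h2]
    | succ d ih =>
      intro k s hk h
      obtain ⟨h1, h2⟩ := hI k s h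
      obtain ⟨t, ht, s', he, hs⟩ := hbody k (by omega) s h
      obtain ⟨t', ht', s'', he', hs'⟩ := ih (k + 1) _ (by omega) hs
      refine ⟨(t + 1) + t' + 1, ?_, s'', .loop_true ?_ (.seq he (.op _ _)) he', hs'⟩
      · rw [Nat.succ_mul]; omega
      · simp only [Cond.holds, h1, h2]; omega
  exact Runs.seq_op (key m 0 _ (by omega) h0)

theorem MState.set_reg (s : MState) (x v y : ℕ) :
    (s.set x v).reg y = if y = x then v else s.reg y := rfl

theorem MState.set_arr (s : MState) (x v : ℕ) : (s.set x v).arr = s.arr := rfl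

theorem Cell.put_reg (c : Cell) (v : EReal) (s : MState) : (c.put v s).reg = s.reg := rfl

theorem Cell.put_arr (c : Cell) (v : EReal) (s : MState) (a i j : ℕ) :
    (c.put v s).arr a i j =
      if a = c.a ∧ i = s.reg c.row ∧ j = s.reg c.col then v else s.arr a i j := rfl

/-- The state `s` agrees with `s₀` on the registers `0, …, 4` and on the input arrays, register `7`
holds `1` and register `8` holds `V`. -/
structure Env (s₀ : MState) (V : ℕ) (s : MState) : Prop where
  reg : ∀ x ≤ 4, s.reg x = s₀.reg x
  one : s.reg 7 = 1
  size : s.reg 8 = V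
  arr : ∀ a < 4, s.arr a = s₀.arr a

namespace Env

variable {s₀ s : MState} {V : ℕ}

theorem set (h : Env s₀ V s) {x : ℕ} (v : ℕ) (hx : x = 5 ∨ 10 ≤ x) : Env s₀ V (s.set x v) where
  reg y hy := by rw [MState.set_reg, if_neg (by omega), h.reg y hy]
  one := by rw [MState.set_reg, if_neg (by omega), h.one]
  size := by rw [MState.set_reg, if_neg (by omega), h.size]
  arr := h.arr

theorem put (h : Env s₀ V s) {c : Cell} (v : EReal) (hc : 4 ≤ c.a) : Env s₀ V (c.put v s) where
  reg := h.reg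
  one := h.one
  size := h.size
  arr a ha := by
    rw [← h.arr a ha]
    ext i j
    rw [Cell.put_arr, if_neg (by omega)]

end Env

/-- During a row by row rewriting of the `V × V` array `4`, the cells before `(i, j)` have been
changed from `D` to `D'`. -/
def Mixed (V : ℕ) (D D' : ℕ → ℕ → EReal) (i j : ℕ) (s : MState) : Prop :=
  ∀ p q, p < V → q < V → s.arr 4 p q = if p < i ∨ p = i ∧ q < j then D' p q else D p q

namespace Mixed

variable {V i j : ℕ} {D D' : ℕ → ℕ → EReal} {s : MState}

theorem next_row (h : Mixed V D D' i V s) : Mixed V D D' (i + 1) 0 s := by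
  intro p q hp hq
  rw [h p q hp hq]
  congr 1
  simp only [eq_iff_iff]
  omega

theorem start (s : MState) : Mixed V (s.arr 4) D' 0 0 s := by
  intro p q _ _
  simp

theorem finish (h : Mixed V D D' V 0 s) {p q : ℕ} (hp : p < V) (hq : q < V) :
    s.arr 4 p q = D' p q := by
  rw [h p q hp hq, if_pos (Or.inl hp)]

theorem cell (h : Mixed V D D' i j s) (hi : i < V) (hj : j < V) : s.arr 4 i j = D i j := by
  rw [h i j hi hj, if_neg (by omega)]

/-- A step that writes the cell `(i, j)`. -/
theorem step (h : Mixed V D D' i j s) {s' : MState}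
    (h1 : s'.arr 4 i j = D' i j)
    (h2 : ∀ p q, p ≠ i ∨ q ≠ j → s'.arr 4 p q = s.arr 4 p q) : Mixed V D D' i (j + 1) s' := by
  intro p q hp hq
  by_cases hpq : p = i ∧ q = j
  · obtain ⟨rfl, rfl⟩ := hpq
    rw [h1, if_pos (by omega)]
  · rw [h2 p q (by omega), h p q hp hq]
    congr 1
    simp only [eq_iff_iff]
    omega

end Mixed

/-! ## The Floyd–Warshall program -/

/-- One step of the Floyd–Warshall algorithm, through the node in register `10`. -/
def pivotProg : Prog :=
  forTo 11 8 <| forTo 12 8 <|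
    .seq (.op (.vadd ⟨5, 11, 12⟩ ⟨4, 11, 10⟩ ⟨4, 10, 12⟩))
      (.op (.vmax ⟨4, 11, 12⟩ ⟨4, 11, 12⟩ ⟨5, 11, 12⟩))

theorem runs_pivotProg {s₀ s : MState} {V k : ℕ} (hs : Env s₀ V s) (hk : k < V)
    (h10 : s.reg 10 = k) (hkk : s.arr 4 k k ≤ 0) :
    Runs pivotProg s (V * (V * 4 + 4) + 2) fun s' =>
      Env s₀ V s' ∧ s'.reg 10 = k ∧ s'.reg 5 = s.reg 5 ∧
      ∀ p q, p < V → q < V → s'.arr 4 p q = pivot k (s.arr 4) p q := by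
  set D := s.arr 4 with hD
  refine (Runs.forTo (m := V) (T := V * 4 + 2)
    (I := fun i s' => s'.reg 11 = i ∧ Env s₀ V s' ∧ s'.reg 10 = k ∧ s'.reg 5 = s.reg 5 ∧
      Mixed V D (pivot k D) i 0 s') ?_ ?_ ?_).mono le_rfl ?_
  · exact ⟨rfl, hs.set _ (by omega), h10, rfl, Mixed.start s⟩
  · rintro i s' ⟨h, henv, -⟩
    exact ⟨h, henv.size⟩
  · rintro i hi s' ⟨h11, henv, hk10, h5, hmix⟩
    refine (Runs.forTo (m := V) (T := 2)
      (I := fun j s' => s'.reg 12 = j ∧ s'.reg 11 = i ∧ Env s₀ V s' ∧ s'.reg 10 = k ∧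
        s'.reg 5 = s.reg 5 ∧ Mixed V D (pivot k D) i j s') ?_ ?_ ?_).mono le_rfl ?_
    · exact ⟨rfl, h11, henv.set _ (by omega), hk10, h5, hmix⟩
    · rintro j s' ⟨h, -, henv, -⟩
      exact ⟨h, henv.size⟩
    · rintro j hj s' ⟨h12, h11, henv, hk10, h5, hmix⟩
      refine Runs.seq_op (Runs.op ?_)
      refine ⟨by simp [Instr.run, MState.set_reg, Cell.put_reg, h12, henv.one],
        by simp [Instr.run, MState.set_reg, Cell.put_reg, h11],
        ((henv.put _ (by simp)).put _ (by simp)).set _ (by omega),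
        by simp [Instr.run, MState.set_reg, Cell.put_reg, hk10],
        by simp [Instr.run, MState.set_reg, Cell.put_reg, h5], ?_⟩
      -- Pivot row and column are the same before and after their update, so the stage of the sweep
      -- does not matter.
      have e1 : s'.arr 4 i k = D i k := by
        rw [hmix i k hi hk, pivot_col hkk, ite_self]
      have e2 : s'.arr 4 k j = D k j := by
        rw [hmix k j hk hj, pivot_row hkk, ite_self]
      refine hmix.step ?_ ?_
      · simp [Instr.run, MState.set_arr, Cell.put_arr, Cell.put_reg, Cell.get, h11, h12, hk10, e1,
          e2, hmix.cell hi hj, pivot]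
      · intro p q hpq
        simp only [Instr.run, MState.set_arr, Cell.put_arr, Cell.put_reg, h11, h12]
        rw [if_neg (by omega), if_neg (by omega)]
    · rintro s' ⟨h12, h11, henv, hk10, h5, hmix⟩
      exact ⟨by simp [MState.set_reg, h11, henv.one], henv.set _ (by omega),
        by simp [MState.set_reg, hk10], by simp [MState.set_reg, h5], hmix.next_row⟩
  · rintro s' ⟨-, henv, hk10, h5, hmix⟩
    exact ⟨henv, hk10, h5, fun p q hp hq => hmix.finish hp hq⟩

/-- The Floyd–Warshall algorithm on array `4`; register `5` is set to `0` when a positive diagonal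
entry occurs. -/
def closureProg : Prog :=
  .seq (.op (.const 5 1)) <| forTo 10 8 <|
    .seq (.op (.vzero ⟨5, 10, 10⟩)) <|
    .ite (.cellLt ⟨5, 10, 10⟩ ⟨4, 10, 10⟩) (.op (.const 5 0)) pivotProg

theorem runs_closureProg {s₀ s : MState} {V : ℕ} (hs : Env s₀ V s) {A : Fin V → Fin V → EReal}
    (hA : ∀ i j : Fin V, s.arr 4 i j = A i j) (htop : ∀ i j, A i j ≠ ⊤) :
    Runs closureProg s (V * (V * (V * 4 + 4) + 6) + 3) fun s' =>
      Env s₀ V s' ∧ ((∃ x, IsPotential A x) → s'.reg 5 = 1) ∧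
      ((¬ ∃ x, IsPotential A x) → s'.reg 5 = 0) := by
  refine Runs.seq_op ?_
  -- While the flag is `1`, `D` dominates `A` but keeps all its potentials, so a positive diagonal
  -- entry excludes potentials of `A`. Once the flag is `0`, the array no longer matters.
  refine (Runs.forTo (m := V) (T := V * (V * 4 + 4) + 4)
    (I := fun k s' => s'.reg 10 = k ∧ Env s₀ V s' ∧
      (s'.reg 5 = 0 ∧ (¬ ∃ x, IsPotential A x) ∨
      s'.reg 5 = 1 ∧ ∃ D : Fin V → Fin V → EReal, (∀ i j : Fin V, s'.arr 4 i j = D i j) ∧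
        (∀ i j, A i j ≤ D i j) ∧ (∀ i j, D i j ≠ ⊤) ∧ ClosedOn {l : Fin V | (l : ℕ) < k} D ∧
        ∀ x, IsPotential A x → IsPotential D x)) ?_ ?_ ?_).mono le_rfl ?_
  · exact ⟨rfl, (hs.set _ (by omega)).set _ (by omega), Or.inr ⟨rfl, A, hA, fun _ _ => le_rfl, htop,
      by simp [ClosedOn], fun _ h => h⟩⟩
  · rintro k s' ⟨h, henv, -⟩
    exact ⟨h, henv.size⟩
  · rintro k hk s' ⟨h10, henv, hcase⟩
    have hread : ∀ p q, (Cell.put ⟨5, 10, 10⟩ 0 s').arr 4 p q = s'.arr 4 p q := by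
      intro p q
      simp [Cell.put_arr]
    have hholds : (Cond.cellLt ⟨5, 10, 10⟩ ⟨4, 10, 10⟩).holds (Instr.run (.vzero ⟨5, 10, 10⟩) s') ↔
        0 < s'.arr 4 k k := by
      simp [Cond.holds, Cell.get, Instr.run, Cell.put_arr, Cell.put_reg, h10]
    refine Runs.seq_op (Runs.ite (fun h => Runs.op ?_) (fun h => ?_))
    · rw [hholds] at h
      refine ⟨by simp [Instr.run, MState.set_reg, Cell.put_reg, h10, henv.one],
        ((henv.put _ (by simp)).set _ (by omega)).set _ (by omega), Or.inl
          ⟨by simp [Instr.run, MState.set_reg], ?_⟩⟩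
      rcases hcase with ⟨-, hno⟩ | ⟨-, D, hD, -, -, -, hpot⟩
      · exact hno
      · rintro ⟨x, hx⟩
        have := (hpot x hx).diag ⟨k, hk⟩
        rw [← hD] at this
        exact absurd this (not_le.2 h)
    · rw [hholds, not_lt] at h
      refine (runs_pivotProg (henv.put _ (by simp)) hk (by simpa [Instr.run, Cell.put_reg] using h10)
        ((hread k k).le.trans h)).mono (by omega) ?_
      rintro s'' ⟨henv', hk10, h5, harr⟩
      refine ⟨by simp [MState.set_reg, hk10, henv'.one], henv'.set _ (by omega), ?_⟩
      have h5' : s''.reg 5 = s'.reg 5 := h5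
      rcases hcase with ⟨h0, hno⟩ | ⟨h1, D, hD, hAD, hDtop, hcl, hpot⟩
      · exact Or.inl ⟨by simpa [MState.set_reg, h5'] using h0, hno⟩
      · refine Or.inr ⟨by simpa [MState.set_reg, h5'] using h1, pivot ⟨k, hk⟩ D, ?_,
          fun i j => (hAD i j).trans (le_pivot _ D i j), pivot_ne_top hDtop, ?_,
          fun x hx => (hpot x hx).pivot _⟩
        · intro i j
          have := harr i j i.2 j.2
          rw [MState.set_arr, this]
          simp only [pivot, hread, ← hD]
        · have hset : {l : Fin V | (l : ℕ) < k + 1} = insert ⟨k, hk⟩ {l : Fin V | (l : ℕ) < k} := by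
            ext l
            simp only [Set.mem_ofPred_eq, Set.mem_insert_iff, Fin.ext_iff]
            omega
          rw [hset]
          exact hcl.pivot (by rw [← hD]; exact h)
  · rintro s' ⟨-, henv, hcase⟩
    refine ⟨henv, ?_⟩
    rcases hcase with ⟨h0, hno⟩ | ⟨h1, D, -, hAD, hDtop, hcl, -⟩
    · exact ⟨fun h => absurd h hno, fun _ => h0⟩
    · refine ⟨fun _ => h1, fun hno => absurd ?_ hno⟩
      have : {l : Fin V | (l : ℕ) < V} = Set.univ := by ext l; simp
      rw [this] at hcl
      obtain ⟨x, hx⟩ := hcl.exists_isPotential hDtop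
      exact ⟨x, hx.mono hAD⟩

/-! ## The matrix `M_k` in memory -/

/-- Given the column in register `rb` and the row in register `ra`, pass to the next node. -/
def advanceProg (rb ra : ℕ) : Prog :=
  .seq (.op (.add ra ra 7)) <|
  .ite (.regLt ra 0) .skip (.seq (.op (.const ra 0)) (.op (.add rb rb 7)))

/-- The node number is column times `n` plus row. Carrying both parts along avoids division. -/
theorem runs_advanceProg {rb ra n : ℕ} {s : MState} (hab : rb ≠ ra) (ha : 10 ≤ ra)
    (h7 : s.reg 7 = 1) (h0 : s.reg 0 = n) (hlt : s.reg ra < n) :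
    Runs (advanceProg rb ra) s 4 fun s' => s'.arr = s.arr ∧
      (∀ x, x ≠ rb → x ≠ ra → s'.reg x = s.reg x) ∧
      s'.reg rb * n + s'.reg ra = s.reg rb * n + s.reg ra + 1 ∧ s'.reg ra < n := by
  have hcond : (Cond.regLt ra 0).holds (Instr.run (.add ra ra 7) s) ↔ s.reg ra + 1 < n := by
    simp [Cond.holds, Instr.run, MState.set_reg, show ¬ 0 = ra by omega, h7, h0]
  refine Runs.seq_op (Runs.ite (fun h => Runs.skip ?_) (fun h => Runs.seq_op (Runs.op ?_)))
  · rw [hcond] at h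
    refine ⟨rfl, fun x _ hx => ?_, ?_, ?_⟩
    · simp [Instr.run, MState.set_reg, hx]
    · simp [Instr.run, MState.set_reg, hab, h7]; ring
    · simpa [Instr.run, MState.set_reg, h7] using h
  · rw [hcond] at h
    refine ⟨rfl, fun x hx hx' => ?_, ?_, ?_⟩
    · simp [Instr.run, MState.set_reg, hx, hx']
    · simp [Instr.run, MState.set_reg, hab, hab.symm, h7, show ¬ 7 = ra by omega]
      rw [add_mul]; omega
    · simp [Instr.run, MState.set_reg, hab.symm]; omega

/-- Write the entry of `M_k` for the nodes in the registers `11, 12` and `14, 15` into the cell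
in the registers `10, 13`. -/
def entryProg : Prog :=
  .ite (.regLt 11 14)
    (.seq (.op (.add 16 11 7)) <|
      .ite (.regLt 16 14) (.op (.vbot ⟨4, 10, 13⟩)) (.op (.vneg ⟨4, 10, 13⟩ ⟨3, 15, 12⟩))) <|
  .ite (.regLt 14 11)
    (.seq (.op (.add 16 14 7)) <|
      .ite (.regLt 16 11) (.op (.vbot ⟨4, 10, 13⟩)) <|
        .seq (.op (.vcopy ⟨4, 10, 13⟩ ⟨1, 12, 15⟩)) <|
        .ite (.regLt 12 15) .skip <| .ite (.regLt 15 12) .skip <|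
          .seq (.op (.vzero ⟨5, 10, 13⟩)) (.op (.vmax ⟨4, 10, 13⟩ ⟨4, 10, 13⟩ ⟨5, 10, 13⟩))) <|
  .seq (.op (.vneg ⟨4, 10, 13⟩ ⟨2, 15, 12⟩)) (.op (.vmax ⟨4, 10, 13⟩ ⟨0, 12, 15⟩ ⟨4, 10, 13⟩))

/-- The state `s'` arises from `s` by writing `v` into the cell `(p, q)` of array `4` and by changes
of register `16` and of arrays beyond `4`. -/
structure Wrote (s : MState) (p q : ℕ) (v : EReal) (s' : MState) : Prop where
  reg : ∀ x, x ≠ 16 → s'.reg x = s.reg x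
  arr : ∀ a < 4, s'.arr a = s.arr a
  val : s'.arr 4 p q = v
  rest : ∀ p' q', p' ≠ p ∨ q' ≠ q → s'.arr 4 p' q' = s.arr 4 p' q'

theorem Wrote.put {s s₁ : MState} {p q : ℕ} {v w : EReal} (h : Wrote s p q v s₁)
    (h10 : s.reg 10 = p) (h13 : s.reg 13 = q) : Wrote s p q w (Cell.put ⟨4, 10, 13⟩ w s₁) where
  reg := h.reg
  arr a ha := by
    rw [← h.arr a ha]
    ext i j
    rw [Cell.put_arr, if_neg (by simp only; omega)]
  val := by simp [Cell.put_arr, h.reg, h10, h13]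
  rest p' q' hpq := by
    rw [← h.rest p' q' hpq, Cell.put_arr, if_neg]
    simp only [h.reg 10 (by omega), h.reg 13 (by omega), h10, h13]
    omega

theorem Wrote.refl (s : MState) (p q : ℕ) : Wrote s p q (s.arr 4 p q) s :=
  ⟨fun _ _ => rfl, fun _ _ => rfl, rfl, fun _ _ _ => rfl⟩

theorem Wrote.set {s s₁ : MState} {p q : ℕ} {v : EReal} (h : Wrote s p q v s₁) (x : ℕ) :
    Wrote s p q v (s₁.set 16 x) where
  reg y hy := by rw [MState.set_reg, if_neg hy, h.reg y hy]
  arr := h.arr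
  val := h.val
  rest := h.rest

theorem Wrote.scratch {s s₁ : MState} {p q : ℕ} {v w : EReal} (h : Wrote s p q v s₁) (r c : ℕ) :
    Wrote s p q v (Cell.put ⟨5, r, c⟩ w s₁) where
  reg := h.reg
  arr a ha := by
    rw [← h.arr a ha]
    ext i j
    rw [Cell.put_arr, if_neg (by simp only; omega)]
  val := by simp [Cell.put_arr, h.val]
  rest p' q' hpq := by simp [Cell.put_arr, h.rest p' q' hpq]

theorem Wrote.env {s₀ s s' : MState} {V p q : ℕ} {v : EReal} (h : Wrote s p q v s')
    (hs : Env s₀ V s) : Env s₀ V s' where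
  reg x hx := by rw [h.reg x (by omega), hs.reg x hx]
  one := by rw [h.reg 7 (by omega), hs.one]
  size := by rw [h.reg 8 (by omega), hs.size]
  arr a ha := by rw [h.arr a ha, hs.arr a ha]

namespace PTEG

variable {n : ℕ} {N : PTEG n}

theorem runs_entryProg {s : MState} {k p q : ℕ} (hN : N.Loaded s) (h7 : s.reg 7 = 1)
    (h10 : s.reg 10 = p) (h13 : s.reg 13 = q) {b b' : Fin (k + 1)} {a a' : Fin n}
    (h11 : s.reg 11 = b) (h12 : s.reg 12 = a) (h14 : s.reg 14 = b') (h15 : s.reg 15 = a') :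
    Runs entryProg s 9 (Wrote s p q (N.M k (b, a) (b', a'))) := by
  have w0 := Wrote.refl s p q
  have hne : ∀ {x y : Fin (k + 1)}, (x : ℕ) < y → x ≠ y := fun h h' => by simp [h'] at h
  refine Runs.ite (fun h1 => ?_) (fun h1 => ?_)
  · simp only [Cond.holds, h11, h14] at h1
    refine Runs.mono (T := 3) (Runs.seq_op (Runs.ite (fun h2 => Runs.op ?_)
      (fun h2 => Runs.op ?_))) (by omega) (fun _ h => h)
    · simp [Cond.holds, Instr.run, MState.set_reg, h11, h14, h7] at h2
      have e : N.M k (b, a) (b', a') = ⊥ := by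
        unfold M
        simp only [Fin.ext_iff]
        rw [if_neg (by omega), if_neg (by omega), if_neg (by omega)]
      rw [e]
      exact (w0.set _).put h10 h13
    · simp [Cond.holds, Instr.run, MState.set_reg, h11, h14, h7] at h2
      have e : N.M k (b, a) (b', a') = - s.arr 3 a' a := by
        unfold M
        simp only [Fin.ext_iff]
        rw [if_neg (by omega), if_pos (by omega), matP, (hN a' a).2.2.2]
      rw [e, ← h12, ← h15]
      exact (w0.set _).put h10 h13
  · simp only [Cond.holds, h11, h14] at h1
    refine Runs.ite (fun h2 => ?_) (fun h2 => ?_)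
    · simp only [Cond.holds, h11, h14] at h2
      refine Runs.seq_op (Runs.ite (fun h3 => Runs.op ?_) (fun h3 => Runs.seq_op ?_))
      · simp [Cond.holds, Instr.run, MState.set_reg, h11, h14, h7] at h3
        have e : N.M k (b, a) (b', a') = ⊥ := by
          unfold M
          simp only [Fin.ext_iff]
          rw [if_neg (by omega), if_neg (by omega), if_neg (by omega)]
        rw [e]
        exact (w0.set _).put h10 h13
      · simp [Cond.holds, Instr.run, MState.set_reg, h11, h14, h7] at h3
        have e : N.M k (b, a) (b', a') = max (s.arr 1 a a') (mpOne a a') := by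
          unfold M
          simp only [Fin.ext_iff]
          rw [if_neg (by omega), if_neg (by omega), if_pos (by omega), matI, (hN a a').2.1]
        have w1 : Wrote s p q (s.arr 1 a a') ((Instr.vcopy ⟨4, 10, 13⟩ ⟨1, 12, 15⟩).run
            ((Instr.add 16 14 7).run s)) := by
          rw [← h12, ← h15]
          exact (w0.set _).put h10 h13
        set s₁ := (Instr.vcopy ⟨4, 10, 13⟩ ⟨1, 12, 15⟩).run ((Instr.add 16 14 7).run s)
        have g12 : s₁.reg 12 = a := by rw [w1.reg 12 (by omega), h12]
        have g15 : s₁.reg 15 = a' := by rw [w1.reg 15 (by omega), h15]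
        -- Equality of rows is tested by two failing strict comparisons.
        refine Runs.ite (fun h4 => Runs.skip ?_) (fun h4 => Runs.ite (fun h5 => Runs.skip ?_)
          (fun h5 => Runs.seq_op (Runs.op (T := 0) ?_)))
        · simp only [Cond.holds, g12, g15] at h4
          have : mpOne a a' = ⊥ := if_neg fun h => by simp [h] at h4
          rw [e, this, max_bot_right]
          exact w1
        · simp only [Cond.holds, g12, g15] at h5
          have : mpOne a a' = ⊥ := if_neg fun h => by simp [h] at h5
          rw [e, this, max_bot_right]
          exact w1
        · simp only [Cond.holds, g12, g15] at h4 h5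
          have : mpOne a a' = 0 := if_pos (Fin.ext (by omega))
          rw [e, this]
          convert (w1.scratch 10 13 (w := 0)).put h10 h13 using 1
          simp [Instr.run, Cell.get, Cell.put_reg, Cell.put_arr, w1.val, w1.reg, h10, h13]
    · simp only [Cond.holds, h11, h14] at h2
      refine Runs.mono (T := 2) (Runs.seq_op (Runs.op ?_)) (by omega) (fun _ h => h)
      have e : N.M k (b, a) (b', a') = max (s.arr 0 a a') (- s.arr 2 a' a) := by
        unfold M
        rw [if_pos (Fin.ext (by simp only; omega)), matC, (hN a a').1, (hN a' a).2.2.1]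
      rw [e]
      convert (w0.put h10 h13 (w := - s.arr 2 a' a)).put h10 h13 using 1
      simp [Instr.run, Cell.get, Cell.put_reg, Cell.put_arr, h12, h15]

end PTEG

/-- Write `M_k` into array `4`. -/
def buildProg : Prog :=
  .seq (.op (.const 11 0)) <| .seq (.op (.const 12 0)) <| forTo 10 8 <|
    .seq (.op (.const 14 0)) <| .seq (.op (.const 15 0)) <|
    .seq (forTo 13 8 (.seq entryProg (advanceProg 14 15))) (advanceProg 11 12)

namespace PTEG

variable {n : ℕ} {N : PTEG n}

/-- The matrix `M_k` with its nodes numbered column by column. -/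
noncomputable def flatM (N : PTEG n) (k : ℕ) (p q : Fin ((k + 1) * n)) : EReal :=
  N.M k (finProdFinEquiv.symm p) (finProdFinEquiv.symm q)

theorem exists_node {k p b a : ℕ} (hp : p < (k + 1) * n) (h : b * n + a = p) (ha : a < n) :
    ∃ hb : b < k + 1, finProdFinEquiv.symm (⟨p, hp⟩ : Fin ((k + 1) * n)) = (⟨b, hb⟩, ⟨a, ha⟩) := by
  have hb : b < k + 1 := by
    by_contra! hb
    have := Nat.mul_le_mul_right n hb
    omega
  refine ⟨hb, ?_⟩
  rw [Equiv.symm_apply_eq]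
  ext
  simp only [finProdFinEquiv_apply_val]
  rw [← h]; ring

theorem runs_buildProg {s₀ s : MState} {k : ℕ} (hN : N.Loaded s₀) (h0 : s₀.reg 0 = n) (hn : 0 < n)
    (hs : Env s₀ ((k + 1) * n) s) :
    Runs buildProg s ((k + 1) * n * ((k + 1) * n * 15 + 10) + 4) fun s' =>
      Env s₀ ((k + 1) * n) s' ∧ ∀ p q : Fin ((k + 1) * n), s'.arr 4 p q = N.flatM k p q := by
  set V := (k + 1) * n with hV
  set D' : ℕ → ℕ → EReal := fun p q =>
    if h : p < V ∧ q < V then N.flatM k ⟨p, h.1⟩ ⟨q, h.2⟩ else 0 with hD'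
  have hload : ∀ {s}, Env s₀ V s → N.Loaded s := by
    intro s hs i j
    simp only [hs.arr 0 (by omega), hs.arr 1 (by omega), hs.arr 2 (by omega), hs.arr 3 (by omega)]
    exact hN i j
  refine Runs.seq_op (Runs.seq_op ?_)
  refine (Runs.forTo (m := V) (T := V * 15 + 8)
    (I := fun p s' => s'.reg 10 = p ∧ Env s₀ V s' ∧ s'.reg 11 * n + s'.reg 12 = p ∧
      s'.reg 12 < n ∧ Mixed V (s.arr 4) D' p 0 s') ?_ ?_ ?_).mono le_rfl ?_
  · exact ⟨rfl, ((hs.set _ (by omega)).set _ (by omega)).set _ (by omega),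
      by simp [Instr.run, MState.set_reg], by simpa [Instr.run, MState.set_reg] using hn,
      Mixed.start s⟩
  · rintro p s' ⟨h, henv, -⟩
    exact ⟨h, henv.size⟩
  · rintro p hp s₁ ⟨h10, henv, hsum, h12, hmix⟩
    refine Runs.mono (T := V * 15 + 2 + 4 + 1 + 1) (Runs.seq_op (Runs.seq_op (Runs.seq ?_)))
      (by omega) (fun _ h => h)
    refine (Runs.forTo (m := V) (T := 13)
      (I := fun q s' => s'.reg 13 = q ∧ s'.reg 10 = p ∧ Env s₀ V s' ∧
        s'.reg 11 * n + s'.reg 12 = p ∧ s'.reg 12 < n ∧ s'.reg 14 * n + s'.reg 15 = q ∧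
        s'.reg 15 < n ∧ Mixed V (s.arr 4) D' p q s') ?_ ?_ ?_).mono le_rfl ?_
    · exact ⟨rfl, h10, ((henv.set _ (by omega)).set _ (by omega)).set _ (by omega),
        hsum, h12, by simp [Instr.run, MState.set_reg],
        by simpa [Instr.run, MState.set_reg] using hn, hmix⟩
    · rintro q s' ⟨h, -, henv, -⟩
      exact ⟨h, henv.size⟩
    · rintro q hq s₂ ⟨h13, h10, henv, hsum, h12, hsum', h15, hmix⟩
      obtain ⟨hb, hnode⟩ := exists_node (hV ▸ hp) hsum h12
      obtain ⟨hb', hnode'⟩ := exists_node (hV ▸ hq) hsum' h15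
      refine Runs.seq (T := 9) (T' := 4) ((runs_entryProg (k := k) (hload henv) henv.one h10 h13
        (b := ⟨_, hb⟩) (b' := ⟨_, hb'⟩) (a := ⟨_, h12⟩) (a' := ⟨_, h15⟩) rfl rfl rfl rfl).mono
        le_rfl fun s₃ w => ?_)
      have henv3 := w.env henv
      refine (runs_advanceProg (rb := 14) (ra := 15) (n := n) (by omega) (by omega)
        henv3.one (by rw [henv3.reg 0 (by omega), h0])
        (by rw [w.reg 15 (by omega)]; exact h15)).mono le_rfl ?_
      rintro s₄ ⟨harr, hreg, hnext, hlt⟩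
      have r : ∀ x, x ≠ 14 → x ≠ 15 → x ≠ 16 → s₄.reg x = s₂.reg x := fun x h h' h'' => by
        rw [hreg x h h', w.reg x h'']
      have henv4 : Env s₀ V s₄ :=
        ⟨fun x hx => by rw [hreg x (by omega) (by omega), henv3.reg x hx],
          by rw [hreg 7 (by omega) (by omega), henv3.one],
          by rw [hreg 8 (by omega) (by omega), henv3.size],
          fun a ha => by rw [harr, henv3.arr a ha]⟩
      refine ⟨?_, ?_, henv4.set _ (by omega), ?_, ?_, ?_, ?_, ?_⟩
      · simp [MState.set_reg, r, h13, henv.one]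
      · simp [MState.set_reg, r, h10]
      · simpa [MState.set_reg, r] using hsum
      · simpa [MState.set_reg, r] using h12
      · simp only [MState.set_reg]
        rw [if_neg (by omega), if_neg (by omega), hnext, w.reg 14 (by omega), w.reg 15 (by omega),
          hsum']
      · simpa [MState.set_reg] using hlt
      · refine hmix.step ?_ ?_
        · rw [MState.set_arr, harr, w.val, hD']
          simp only
          rw [dif_pos ⟨hp, hq⟩, flatM, hnode, hnode']
        · intro p' q' hpq
          rw [MState.set_arr, harr, w.rest p' q' hpq]
    · rintro s₂ ⟨-, h10, henv, hsum, h12, -, -, hmix⟩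
      refine (runs_advanceProg (rb := 11) (ra := 12) (n := n) (by omega) (by omega)
        henv.one (by rw [henv.reg 0 (by omega), h0]) h12).mono le_rfl ?_
      rintro s₄ ⟨harr, hreg, hnext, hlt⟩
      have henv4 : Env s₀ V s₄ :=
        ⟨fun x hx => by rw [hreg x (by omega) (by omega), henv.reg x hx],
          by rw [hreg 7 (by omega) (by omega), henv.one],
          by rw [hreg 8 (by omega) (by omega), henv.size],
          fun a ha => by rw [harr, henv.arr a ha]⟩
      refine ⟨?_, henv4.set _ (by omega), ?_, ?_, ?_⟩
      · simp [MState.set_reg, hreg, h10, henv.one]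
      · simp only [MState.set_reg]
        rw [if_neg (by omega), if_neg (by omega), hnext, hsum]
      · simpa [MState.set_reg] using hlt
      · intro p' q' hp' hq'
        rw [MState.set_arr, harr]
        exact hmix.next_row p' q' hp' hq'
  · rintro s' ⟨-, henv, -, -, hmix⟩
    refine ⟨henv, fun p q => ?_⟩
    rw [hmix.finish p.2 q.2, hD']
    simp only
    rw [dif_pos ⟨p.2, q.2⟩]

theorem exists_isPotential_flatM_iff (k : ℕ) :
    (∃ x, IsPotential (N.flatM k) x) ↔ InGamma (N.M k) := by
  rw [inGamma_iff_exists_isPotential (N.M_ne_top k)]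
  constructor
  · rintro ⟨x, hx⟩
    refine ⟨fun a => x (finProdFinEquiv a), fun a b => ?_⟩
    simpa [flatM] using hx (finProdFinEquiv a) (finProdFinEquiv b)
  · rintro ⟨x, hx⟩
    exact ⟨fun p => x (finProdFinEquiv.symm p), fun p q => hx _ _⟩

end PTEG

/-- Decide whether `M_k` has a circuit of positive weight. -/
def gammaTest : Prog :=
  .seq (.op (.const 7 1)) <| .seq (.op (.add 9 4 7)) <| .seq (.op (.const 8 0)) <|
  .seq (forTo 10 9 (.op (.add 8 8 0))) <| .seq buildProg closureProg

theorem decidesGamma_gammaTest : DecidesGamma gammaTest 100 := by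
  intro n N k s hn hN h0 h4
  set V := (k + 1) * n with hV
  have key : Runs gammaTest s
      ((((k + 1) * 3 + 2) + ((V * (V * 15 + 10) + 4) + (V * (V * (V * 4 + 4) + 6) + 3))) + 1 + 1 + 1)
      fun s' => Env s V s' ∧ (InGamma (N.M k) → s'.reg 5 = 1) ∧
        (¬ InGamma (N.M k) → s'.reg 5 = 0) := by
    refine Runs.seq_op (Runs.seq_op (Runs.seq_op (Runs.seq ?_)))
    -- The machine has no multiplication, so `(k + 1) * n` is computed by repeated addition.
    refine (Runs.forTo (m := k + 1) (T := 1)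
      (I := fun j s' => s'.reg 10 = j ∧ s'.reg 9 = k + 1 ∧ s'.reg 8 = j * n ∧ s'.reg 7 = 1 ∧
        (∀ x ≤ 4, s'.reg x = s.reg x) ∧ ∀ a < 4, s'.arr a = s.arr a) ?_ ?_ ?_).mono le_rfl ?_
    · refine ⟨rfl, by simp [Instr.run, MState.set_reg, h4], by simp [Instr.run, MState.set_reg],
        rfl, fun x hx => ?_, fun _ _ => rfl⟩
      simp only [Instr.run, MState.set_reg]
      rw [if_neg (by omega), if_neg (by omega), if_neg (by omega), if_neg (by omega)]
    · rintro j s' ⟨h, h', -⟩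
      exact ⟨h, h'⟩
    · rintro j hj s' ⟨h10, h9, h8, h7, hreg, harr⟩
      refine Runs.op (T := 0) ⟨?_, ?_, ?_, ?_, fun x hx => ?_, harr⟩
      · simp [Instr.run, MState.set_reg, h10, h7]
      · simp [Instr.run, MState.set_reg, h9]
      · simp [Instr.run, MState.set_reg, h8, hreg 0, h0, add_mul]
      · simp [Instr.run, MState.set_reg, h7]
      · simp only [Instr.run, MState.set_reg]
        rw [if_neg (by omega), if_neg (by omega), hreg x hx]
    · rintro s₁ ⟨-, -, h8, h7, hreg, harr⟩
      refine Runs.seq ((PTEG.runs_buildProg (k := k) hN h0 hn ⟨hreg, h7, h8, harr⟩).mono le_rfl ?_)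
      rintro s₂ ⟨henv, hM⟩
      refine (runs_closureProg henv hM fun _ _ => N.M_ne_top k _ _).mono le_rfl ?_
      rintro s₃ ⟨henv', h1, h2⟩
      rw [PTEG.exists_isPotential_flatM_iff] at h1 h2
      exact ⟨henv', h1, h2⟩
  obtain ⟨T, hT, s', he, henv, h1, h2⟩ := key
  refine ⟨T, s', he, ?_, h1, h2, henv.reg, henv.arr⟩
  have hVk : k + 1 ≤ V := Nat.le_mul_of_pos_right _ hn
  have hV2 : V ≤ V ^ 2 := Nat.le_self_pow (by omega) V
  have hV3 : V ^ 2 ≤ V ^ 3 := Nat.pow_le_pow_right (by omega) (by omega)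
  have hT' : T ≤ 100 * V ^ 3 := by
    have : V * (V * 15 + 10) = 15 * V ^ 2 + 10 * V := by ring
    have : V * (V * (V * 4 + 4) + 6) = 4 * V ^ 3 + 4 * V ^ 2 + 6 * V := by ring
    omega
  have : ((n : ℝ) * (k + 1)) = (V : ℝ) := by rw [hV]; push_cast; ring
  rw [this]
  exact_mod_cast hT'

/-! ## Binary search -/

namespace PTEG

variable {n : ℕ} {N : PTEG n}

/-- The interval between registers `2` and `3` always contains `k`, and each round halves the bound
`2 ^ d` on its length. -/
theorem runs_search {test : Prog} {c : ℕ} (htest : DecidesGamma test c) (hn : 0 < n) {k H : ℕ}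
    (hk : ∀ m, InGamma (N.M m) ↔ m < k) (d : ℕ) {s : MState} (hN : N.Loaded s)
    (h0 : s.reg 0 = n) (hlo : s.reg 2 ≤ k) (hhi : k ≤ s.reg 3) (hH : s.reg 3 ≤ H)
    (hd : s.reg 3 - s.reg 2 < 2 ^ d) :
    Runs (.loop (.regLt 2 3) <|
      .seq (.op (.add 4 2 3)) <| .seq (.op (.half 4 4)) <| .seq test <|
      .seq (.op (.const 6 0)) <| .ite (.regLt 6 5)
        (.seq (.op (.const 6 1)) (.op (.add 2 4 6))) (.op (.copy 3 4)))
      s (d * (c * (n * H) ^ 3 + 7) + 1) fun s' => s'.reg 2 = k := by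
  induction d generalizing s with
  | zero =>
    refine ⟨1, by omega, s, .loop_false ?_, ?_⟩
    · simp only [Cond.holds]; omega
    · omega
  | succ d ih =>
    by_cases hlt : s.reg 2 < s.reg 3
    · set m := (s.reg 2 + s.reg 3) / 2 with hm
      set s₁ := (Instr.half 4 4).run ((Instr.add 4 2 3).run s) with hs₁
      have r4 : s₁.reg 4 = m := by simp [hs₁, Instr.run, MState.set_reg, hm]
      have r : ∀ x, x ≠ 4 → s₁.reg x = s.reg x := fun x hx => by
        simp [hs₁, Instr.run, MState.set_reg, hx]
      obtain ⟨T, s₂, he, hT, hyes, hno, hreg, harr⟩ := htest n N m s₁ hn hN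
        (by rw [r 0 (by omega), h0]) r4
      -- The midpoint is strictly below the upper end, so `m + 1 ≤ H`.
      have hT' : T ≤ c * (n * H) ^ 3 := by
        have h1 : T ≤ c * (n * (m + 1)) ^ 3 := by exact_mod_cast hT
        refine h1.trans ?_
        gcongr
        omega
      have q0 : s₂.reg 0 = n := by rw [hreg 0 (by omega), r 0 (by omega), h0]
      have q2 : s₂.reg 2 = s.reg 2 := by rw [hreg 2 (by omega), r 2 (by omega)]
      have q3 : s₂.reg 3 = s.reg 3 := by rw [hreg 3 (by omega), r 3 (by omega)]
      have q4 : s₂.reg 4 = m := by rw [hreg 4 (by omega), r4]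
      have hN₂ : N.Loaded s₂ := by
        intro i j
        rw [harr 0 (by omega), harr 1 (by omega), harr 2 (by omega), harr 3 (by omega)]
        exact hN i j
      have hpow : 2 ^ (d + 1) = 2 * 2 ^ d := by ring
      suffices h : Runs (.seq (.op (.const 6 0)) <| .ite (.regLt 6 5)
          (.seq (.op (.const 6 1)) (.op (.add 2 4 6))) (.op (.copy 3 4))) s₂ 4
          fun s' => N.Loaded s' ∧ s'.reg 0 = n ∧ s'.reg 2 ≤ k ∧ k ≤ s'.reg 3 ∧ s'.reg 3 ≤ H ∧
            s'.reg 3 - s'.reg 2 < 2 ^ d by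
        obtain ⟨T', hT'', s₃, he', g1, g2, g3, g4, g5, g6⟩ := h
        obtain ⟨T'', hT''', s₄, he'', hfin⟩ := ih g1 g2 g3 g4 g5 g6
        refine ⟨_, ?_, s₄, .loop_true hlt (.seq (.op _ _) (.seq (.op _ _) (.seq he he'))) he'', hfin⟩
        rw [Nat.succ_mul]
        omega
      refine Runs.seq_op (Runs.ite (fun h => Runs.seq_op (Runs.op (T := 0) ?_))
        (fun h => Runs.op (T := 1) ?_))
      · have hk' : m < k := by
          by_contra hmk
          have := hno (by rwa [hk])
          simp [Cond.holds, Instr.run, MState.set_reg, this] at h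
        refine ⟨hN₂, ?_, ?_, ?_, ?_, ?_⟩ <;> simp [Instr.run, MState.set_reg, q0, q3, q4] <;> omega
      · have hk' : k ≤ m := by
          by_contra hmk
          have := hyes (by rw [hk]; omega)
          simp [Cond.holds, Instr.run, MState.set_reg, this] at h
        refine ⟨hN₂, ?_, ?_, ?_, ?_, ?_⟩ <;> simp [Instr.run, MState.set_reg, q0, q2, q4] <;> omega
    · exact ⟨1, by omega, s, .loop_false hlt, by omega⟩

theorem runs_binarySearch {test : Prog} {c : ℕ} (htest : DecidesGamma test c) (hn : 0 < n)
    {k H : ℕ} (hk : ∀ m, InGamma (N.M m) ↔ m < k) (hkH : k ≤ H) :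
    Runs (binarySearch test) (N.input H) ((Nat.log 2 H + 1) * (c * (n * H) ^ 3 + 7) + 3)
      fun s => s.reg 2 = k := by
  refine Runs.seq_op (Runs.seq_op ?_)
  refine runs_search htest hn hk _ ?_ ?_ ?_ ?_ ?_ ?_
  · intro i j
    simp [Instr.run, MState.set_arr, input]
  · simp [Instr.run, MState.set_reg, input]
  · simp [Instr.run, MState.set_reg]
  · simpa [Instr.run, MState.set_reg, input] using hkH
  · simp [Instr.run, MState.set_reg, input]
  · simpa [Instr.run, MState.set_reg, input] using Nat.lt_pow_succ_log_self (by omega) H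

end PTEG

/-! ### Running time of the search and the main theorem -/

theorem search_time_le {n H T : ℕ} (hn : 0 < n) (hH : 3 ≤ H)
    (hT : T ≤ (Nat.log 2 H + 1) * (100 * (n * H) ^ 3 + 7) + 3) :
    (T : ℝ) ≤ 400 * ((n : ℝ) ^ 3 * (H : ℝ) ^ 3 * Real.log H) := by
  have hH' : (3 : ℝ) ≤ H := by exact_mod_cast hH
  -- This is where `3 ≤ H` enters, as `e < 3`; it absorbs the additive constants.
  have hlog1 : 1 ≤ Real.log H := by
    rw [Real.le_log_iff_exp_le (by linarith)]
    have := Real.exp_one_lt_d9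
    linarith
  -- The factor `2` comes from `log 2 > 1 / 2`.
  have hlog2 : (Nat.log 2 H : ℝ) ≤ 2 * Real.log H := by
    have h1 : ((2 : ℝ) ^ Nat.log 2 H) ≤ H := by
      exact_mod_cast Nat.pow_log_le_self 2 (by omega)
    have h2 := Real.log_le_log (by positivity) h1
    rw [Real.log_pow] at h2
    have h3 := Real.log_two_gt_d9
    nlinarith [Nat.cast_nonneg (α := ℝ) (Nat.log 2 H)]
  have hX : (1 : ℝ) ≤ (n : ℝ) ^ 3 * (H : ℝ) ^ 3 := by
    have : 1 ≤ n ^ 3 * H ^ 3 := Nat.mul_pos (by positivity) (by positivity)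
    exact_mod_cast this
  have hT' : (T : ℝ) ≤ (Nat.log 2 H + 1) * (100 * ((n : ℝ) * H) ^ 3 + 7) + 3 := by
    exact_mod_cast hT
  rw [mul_pow] at hT'
  set X := (n : ℝ) ^ 3 * (H : ℝ) ^ 3
  have h4 : ((Nat.log 2 H : ℝ) + 1) * (100 * X + 7) ≤ (3 * Real.log H) * (107 * X) :=
    mul_le_mul (by linarith) (by linarith) (by linarith) (by linarith)
  have h5 : 1 ≤ X * Real.log H := by nlinarith
  nlinarith

theorem DecidesGamma.mono {test : Prog} {c d : ℝ} (h : DecidesGamma test c) (hcd : c ≤ d) :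
    DecidesGamma test d := by
  intro n N k s hn hN h0 h4
  obtain ⟨T, s', he, hT, h⟩ := h n N k s hn hN h0 h4
  exact ⟨T, s', he, hT.trans (by gcongr), h⟩

theorem mainTheorem3 :
    ∃ (test : Prog) (c : ℝ), DecidesGamma test c ∧
      ∀ (n : ℕ) (N : PTEG n), ¬ N.WeaklyConsistent →
        (∃ (i j : Fin n) (t : ℤ) (w : ℝ) (t' : ℤ) (w' : ℝ), N.IsWitness i j t w t' w') ∧
        ∀ (i j : Fin n) (t : ℤ) (w : ℝ) (t' : ℤ) (w' : ℝ), N.IsWitness i j t w t' w' →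
          (∃ q : ℕ × ℕ, Minimal (N.IsSol i j t w t' w') q) ∧
          ∀ y y' : ℕ, Minimal (N.IsSol i j t w t' w') (y, y') →
            ∃ k ≤ horizon n t y,
              N.IsFirstDeath k ∧
              IsLeast {K : ℕ | ¬ InGamma (N.M K)} k ∧
              IsGreatest {m : ℕ | N.AdmitsFirings m} k ∧
              ∃ (T : ℕ) (s : MState),
                Exec (binarySearch test) (N.input (horizon n t y)) T s ∧
                s.reg 2 = k ∧
                (T : ℝ) ≤ c * ((n : ℝ) ^ 3 * (horizon n t y : ℝ) ^ 3 *
                  Real.log (horizon n t y)) := by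
  refine ⟨gammaTest, 400, decidesGamma_gammaTest.mono (by norm_num), fun n N hN =>
    ⟨PTEG.exists_isWitness hN, fun i j t w t' w' hwit =>
      ⟨PTEG.exists_minimal_isSol hwit, fun y y' hmin => ?_⟩⟩⟩
  classical
  have hH : ¬ InGamma (N.M (horizon n t y)) := by
    rw [N.inGamma_M_iff]
    rintro ⟨x, hx⟩
    exact PTEG.not_consistentUpTo_horizon hwit.2.1 hwit.2.2.1 hmin.1 x hx
  have hex : ∃ K, ¬ InGamma (N.M K) := ⟨_, hH⟩
  set k := Nat.find hex with hk
  have hleast : IsLeast {K : ℕ | ¬ InGamma (N.M K)} k :=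
    ⟨Nat.find_spec hex, fun m hm => Nat.find_min' hex hm⟩
  have hkH : k ≤ horizon n t y := hleast.2 hH
  -- Consistency passes to prefixes, so the test is monotone in `m`.
  have hiff : ∀ m, InGamma (N.M m) ↔ m < k := by
    intro m
    constructor
    · intro hm
      by_contra! hkm
      rw [N.inGamma_M_iff] at hm
      obtain ⟨x, hx⟩ := hm
      exact hleast.1 ((N.inGamma_M_iff k).2 ⟨x, hx.mono hkm⟩)
    · intro hm
      by_contra hno
      exact absurd (hleast.2 hno) (not_le.2 hm)
  have hn : 0 < n := i.pos
  obtain ⟨h1, h2⟩ := N.isFirstDeath_and hleast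
  have htest : DecidesGamma gammaTest ((100 : ℕ) : ℝ) := by
    exact_mod_cast decidesGamma_gammaTest
  obtain ⟨T, hT, s, he, hs⟩ := PTEG.runs_binarySearch htest hn hiff hkH
  exact ⟨k, hkH, h1, hleast, h2, T, s, he, hs,
    search_time_le hn (by unfold horizon; omega) hT⟩
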